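/- Let $\mathbb B=\{0,1\}$. An offline estimator is a family $o=(q_s)_{s\ge 0}$ of probability mass functions $q_s:\mathbb B^s\to[0,1]\cap\mathbb Q$. An online estimator is a function $\tilde q:\mathbb B^*\to[0,1]$ with $\tilde q(\epsilon)=1$ ($\epsilon$ the empty string) and $\tilde q(x0)+\tilde q(x1)=\tilde q(x)$ for all $x\in\mathbb B^*$. The regret of $\tilde q$ is $$R_n(\tilde q\|q_n)=\max_{x\in\mathbb B^n}\ln\frac{q_n(x)}{\tilde q(x)}\in[0,+\infty],$$ where strings with $q_n(x)=0$ contribute $-\infty$, and strings with $q_n(x)>0=\tilde q(x)$ contribute $+\infty$. The machine model is that of while programs over finitely many registers that hold pointers to binary trees (list cells); each elementary operation costs one step. An oracle program may also request, in one step, the exact value $q_s(z)$ for any string $z\in\mathbb B^s$, $s\ge 0$, that it holds in a register. Write $o\in\mathrm E^{1}$ if some program without oracle computes $q_s(z)$ exactly from $z\in\mathbb B^s$ in time $O(2^{s})$. For $g:\mathbb N\to\mathbb R$ write $\tilde q\in\mathrm{DTIME}^o(g)$ if some oracle program outputs, for every $x\in\mathbb B^*$ and every rational $\delta>0$, a rational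 number at distance less than $\delta$ from $\tilde q(x)$, in time $O(g(N))$, where $N$ is the length of $x$ plus the lengths of the binary representations of the numerator and the denominator of $\delta$. Let $\mathrm E^{c,o}=\mathrm{DTIME}^o(2^{cn})$ and $\mathrm P^o=\bigcup_{k}\mathrm{DTIME}^o(n^k)$. **Theorem.** For every real $\varepsilon>0$ there is an offline estimator $o=(q_s)\in\mathrm E^{1}$ such that every online estimator $\tilde q\in\mathrm E^{\varepsilon/2,o}$, and likewise every online estimator $\tilde q\in\mathrm P^o$, satisfies $$R_n(\tilde q\|q_n)\;\ge\;(1-\varepsilon)\,n\ln 2\qquad\text{for all but finitely many } n.$$ -/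

import Mathlib

open Filter Topology
open scoped ENNReal

/-! ## Machine model: while programs on binary trees, with an oracle

Registers hold binary trees (Lisp cells). Building a cell, taking a component, copying a pointer,
testing for the empty tree and calling the oracle each cost one step. Every step other than an
oracle call is a constant number of pointer operations on a random access machine, and a
multi-tape Turing machine is simulated with a constant number of steps per move. -/

/-- Data: binary trees; `nil` is the empty tree. -/
inductive Cell : Type
  | nil : Cell
  | cons : Cell → Cell → Cell

namespace Cell

/-- First component (`nil` for the empty tree). -/
def fst : Cell → Cell
  | nil => nil
  | cons a _ => a

/-- Second component (`nil` for the empty tree). -/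
def snd : Cell → Cell
  | nil => nil
  | cons _ b => b

/-- The test for being nonempty. -/
def isCons : Cell → Bool
  | nil => false
  | cons _ _ => true

/-- A bit as a tree. -/
def ofBit : Bool → Cell
  | false => nil
  | true => cons nil nil

/-- A binary string `x₁ … xₙ` as a list of cells with `x₁` in front. -/
def ofBits : List Bool → Cell
  | [] => nil
  | b :: l => cons (ofBit b) (ofBits l)

/-- The binary string denoted by a tree (every tree denotes one). -/
def toBits : Cell → List Bool
  | nil => []
  | cons a b => a.isCons :: toBits b

/-- The natural number denoted by a tree, in binary, least significant bit in front. -/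
def toNat (c : Cell) : ℕ :=
  c.toBits.foldr (fun b n => 2 * n + b.toNat) 0

/-- A nonnegative rational number as the pair of its reduced numerator and denominator in
binary. -/
def ofRat (r : ℚ≥0) : Cell :=
  cons (ofBits r.num.bits) (ofBits r.den.bits)

/-- The nonnegative rational number denoted by a tree: numerator over denominator, not
necessarily in lowest terms. -/
def toRat (c : Cell) : ℚ≥0 :=
  (c.fst.toNat : ℚ≥0) / (c.snd.toNat : ℚ≥0)

end Cell

/-- Programs. Registers are numbered by natural numbers. -/
inductive Prog : Type
  /-- `x := nil` -/
  | clear (x : ℕ) : Prog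
  /-- `x := y` -/
  | copy (x y : ℕ) : Prog
  /-- `x := cons y z` -/
  | cons (x y z : ℕ) : Prog
  /-- `x := fst y` -/
  | fst (x y : ℕ) : Prog
  /-- `x := snd y` -/
  | snd (x y : ℕ) : Prog
  /-- `x := o(y)`, where `o` is the oracle -/
  | query (x y : ℕ) : Prog
  /-- `p; q` -/
  | seq (p q : Prog) : Prog
  /-- `if x ≠ nil then p else q` -/
  | ite (x : ℕ) (p q : Prog) : Prog
  /-- `while x ≠ nil do p` -/
  | loop (x : ℕ) (p : Prog) : Prog

namespace Prog

/-- A configuration: the programs that remain to be executed, in this order, and the contents of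
the registers. The machine has halted when the list is empty. -/
abbrev Config : Type := List Prog × (ℕ → Cell)

/-- One step of the machine with oracle `o`. -/
def step (o : List Bool → ℚ≥0) : Config → Config
  | ([], σ) => ([], σ)
  | (clear x :: K, σ) => (K, Function.update σ x Cell.nil)
  | (copy x y :: K, σ) => (K, Function.update σ x (σ y))
  | (cons x y z :: K, σ) => (K, Function.update σ x (Cell.cons (σ y) (σ z)))
  | (fst x y :: K, σ) => (K, Function.update σ x (σ y).fst)
  | (snd x y :: K, σ) => (K, Function.update σ x (σ y).snd)
  | (query x y :: K, σ) => (K, Function.update σ x (Cell.ofRat (o (σ y).toBits)))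
  | (seq p q :: K, σ) => (p :: q :: K, σ)
  | (ite x p q :: K, σ) => ((if (σ x).isCons then p else q) :: K, σ)
  | (loop x p :: K, σ) => (if (σ x).isCons then p :: loop x p :: K else K, σ)

/-- Initial configuration: inputs in registers `0` and `1`, all other registers empty. -/
def init (p : Prog) (a b : Cell) : Config :=
  ([p], fun i => if i = 0 then a else if i = 1 then b else Cell.nil)

/-- With oracle `o` and inputs `a` and `b`, the program `p` halts within `t` steps, with output
`c` in register `0`. -/
def HaltsWithin (o : List Bool → ℚ≥0) (p : Prog) (a b : Cell) (t : ℕ) (c : Cell) : Prop :=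
  ((step o)^[t] (init p a b)).1 = [] ∧ ((step o)^[t] (init p a b)).2 0 = c

end Prog

/-! ## Time complexity classes -/

/-- `DTIME(g)` for rational-valued functions of binary strings: computable exactly, without
oracle, in time `O(g(n))` on inputs of length `n`. Having no oracle is having the oracle that
always answers `0`, an answer that a program can write down itself in a constant number of
steps. -/
def DTIME (g : ℕ → ℝ) : Set (List Bool → ℚ≥0) :=
  {f | ∃ (p : Prog) (t : ℕ → ℕ), (fun n => (t n : ℝ)) =O[atTop] g ∧
    ∀ x : List Bool, ∃ c : Cell,
      p.HaltsWithin (fun _ => 0) (Cell.ofBits x) Cell.nil (t x.length) c ∧ c.toRat = f x}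

/-- Length of the binary representation of a nonnegative rational number. -/
def ratLength (r : ℚ≥0) : ℕ :=
  r.num.bits.length + r.den.bits.length

/-- `DTIME^o(g)` for real-valued functions of binary strings: there is a program with access to
the oracle `o` which, given `x` and a rational `δ > 0`, outputs a `δ`-approximation of the value
at `x`, in time `O(g(N))` on inputs `(x, δ)` of length `N`. -/
def OracleDTIME (o : List Bool → ℚ≥0) (g : ℕ → ℝ) : Set (List Bool → ℝ) :=
  {f | ∃ (p : Prog) (t : ℕ → ℕ), (fun n => (t n : ℝ)) =O[atTop] g ∧
    ∀ (x : List Bool) (δ : ℚ≥0), 0 < δ → ∃ c : Cell,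
      p.HaltsWithin o (Cell.ofBits x) (Cell.ofRat δ) (t (x.length + ratLength δ)) c ∧
        |(c.toRat : ℝ) - f x| < (δ : ℝ)}

/-- `E^c = DTIME(2^{cn})`. -/
def ExpTime (c : ℝ) : Set (List Bool → ℚ≥0) :=
  DTIME fun n => (2 : ℝ) ^ (c * (n : ℝ))

/-- `E^{c,o} = DTIME^o(2^{cn})`. -/
def OracleExpTime (o : List Bool → ℚ≥0) (c : ℝ) : Set (List Bool → ℝ) :=
  OracleDTIME o fun n => (2 : ℝ) ^ (c * (n : ℝ))

/-- `P^o`, the union of all `DTIME^o(n^k)`. -/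
def OraclePolyTime (o : List Bool → ℚ≥0) : Set (List Bool → ℝ) :=
  ⋃ k : ℕ, OracleDTIME o fun n => (n : ℝ) ^ k

/-! ## Estimators and regret -/

/-- An offline estimator `(q_s)`: a probability mass function on binary strings of length `s`,
for every `s`. -/
def IsOffline (q : List Bool → ℚ≥0) : Prop :=
  ∀ s : ℕ, ∑ x : Fin s → Bool, q (List.ofFn x) = 1

/-- An online estimator: nonnegative, normalized and time-consistent. -/
def IsOnline (q : List Bool → ℝ) : Prop :=
  (∀ x, 0 ≤ q x) ∧ q [] = 1 ∧ ∀ x, q (x ++ [false]) + q (x ++ [true]) = q x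

/-- The worst-case log-loss regret `R_n(q' ‖ q)`, the maximum of `ln (q(x) / q'(x))` over the
strings `x` of length `n`, with values in the extended reals: a string with `q(x) = 0`
contributes `-∞`, and one with `q(x) > 0 = q'(x)` contributes `+∞`. -/
noncomputable def regret (q' : List Bool → ℝ) (q : List Bool → ℚ≥0) (n : ℕ) : EReal :=
  ⨆ x : Fin n → Bool,
    ENNReal.log (ENNReal.ofReal (q (List.ofFn x) : ℝ) / ENNReal.ofReal (q' (List.ofFn x)))

/-!
# Online estimators with an offline oracle

The offline estimator is uniform on a sparse set of strings that is built by diagonalization.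
Strings of length `m` have level `k = m / D`, and stage `m` puts one string `x` of length `m`,
with probability `2 ^ (-k)`, into the support for each of the `2 ^ k` codes of programs of length
`k`. The first `L = m - a * k` bits of `x` are chosen greedily against the program `p` with that
code: having found `w`, simulate `p` in order to approximate the probability of `w0`, and append
`0` if the result is at most `2 ^ (-(|w| + 1))`, and `1` otherwise. If `p` computes an online
estimator `q` in time, then the sum of the probabilities of `w0` and `w1` being that of `w` forces
`q x ≤ (1 + L) * 2 ^ (-L)` (`IsOnline.take_le`). Hence the regret at `m` is at least
`(L - k) * ln 2 - ln (1 + L)`, which exceeds `(1 - ε) * m * ln 2` if `(a + 1) / D < ε`. Every program has codes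
of all large lengths (`eventually_exists_decode`), so this happens for all large `m`
(`Rates.exists_diagonal`).

The program `p` may ask for values of the very estimator that is being constructed. The
interpreter therefore fixes every answer it gives in a table: a string without an entry gets the
entry `0` for good. The last `a * k` bits of `x` are free, and are chosen such that `x` has no
entry yet. There is such a choice because the simulations, of less than `2 ^ (b * k)` steps each,
have fixed few answers (`Rates.Good`, `Rates.addProgram_spec`), where `b` is a little smaller than
`a`. The fixed answers are then correct in the end (`Rates.consistent_table`), so that simulations
that finish are faithful. They finish for all programs with running time `O(2 ^ (ε / 2 * N))` if
`ε * (D - a) < b`, since an input `w0` with precision `2 ^ (-L)` has length `N` about `2 * L`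
(`Rates.eventually_time_le_clock`).

The table is a trie, represented by a tree of the machine model, and the whole construction is a
program of that model. A small logic for programs with named registers (`Runs`) keeps track of the
contents of the registers and of the time. Up to polynomial factors, the program needs
`2 ^ k * (2 ^ (2 * b * k) + 2 ^ (a * k))` steps for a stage, which sums up to `O(2 ^ n)` if `2 * b + 4 ≤ D` and `a + 4 ≤ D`
(`Rates.estimator_mem_expTime`). All conditions on the rates can be met for `ε < 1`
(`exists_rates`). For `ε ≥ 1` the claim is that the regret is not negative.
-/

/-! ### Trees: strings, numbers and rationals as cells -/

namespace Cell

theorem isCons_iff_ne_nil {c : Cell} : c.isCons = true ↔ c ≠ nil := by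
  cases c <;> simp [isCons]

@[simp] theorem isCons_nil : nil.isCons = false := rfl

@[simp] theorem isCons_cons (a b : Cell) : (cons a b).isCons = true := rfl

@[simp] theorem fst_nil : nil.fst = nil := rfl

@[simp] theorem snd_nil : nil.snd = nil := rfl

@[simp] theorem fst_cons (a b : Cell) : (cons a b).fst = a := rfl

@[simp] theorem snd_cons (a b : Cell) : (cons a b).snd = b := rfl

@[simp] theorem toBits_nil : nil.toBits = [] := rfl

@[simp] theorem toBits_cons (a b : Cell) : (cons a b).toBits = a.isCons :: b.toBits := rfl

@[simp] theorem isCons_ofBit (b : Bool) : (ofBit b).isCons = b := by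
  cases b <;> rfl

@[simp] theorem toBits_ofBits (l : List Bool) : (ofBits l).toBits = l := by
  induction l with
  | nil => rfl
  | cons b l ih => simp [ofBits, ih]

/-- The tree of the bit `1`. -/
def one : Cell := cons nil nil

@[simp] theorem isCons_one : one.isCons = true := rfl

/-- The list of `m` empty trees: the natural number `m` in unary. -/
def unary : ℕ → Cell
  | 0 => nil
  | m + 1 => cons nil (unary m)

@[simp] theorem unary_snd (m : ℕ) : (unary m).snd = unary (m - 1) := by
  cases m <;> rfl

theorem iterate_snd_unary (j m : ℕ) : snd^[j] (unary m) = unary (m - j) := by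
  induction j generalizing m with
  | zero => rfl
  | succ j ih => rw [Function.iterate_succ_apply, unary_snd, ih, Nat.sub_sub, Nat.add_comm 1 j]

theorem isCons_unary {m : ℕ} : (unary m).isCons = true ↔ 0 < m := by
  cases m <;> simp [unary]

theorem unary_eq_ofBits (m : ℕ) : unary m = ofBits (List.replicate m false) := by
  induction m with
  | zero => rfl
  | succ m ih => rw [unary, ih]; rfl

@[simp] theorem length_toBits_unary (m : ℕ) : (unary m).toBits.length = m := by
  simp [unary_eq_ofBits]

/-- A list of trees as a tree. -/
def ofList : List Cell → Cell
  | [] => nil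
  | c :: l => cons c (ofList l)

@[simp] theorem ofList_nil : ofList [] = nil := rfl

@[simp] theorem ofList_cons (c : Cell) (l : List Cell) : ofList (c :: l) = cons c (ofList l) := rfl

@[simp] theorem length_toBits_ofList (l : List Cell) : (ofList l).toBits.length = l.length := by
  induction l with
  | nil => rfl
  | cons c l ih => simp [ih]

/-- `revApp c d` is the reversal of the list `c`, followed by `d`. -/
def revApp : Cell → Cell → Cell
  | nil, d => d
  | cons a c, d => revApp c (cons a d)

theorem revApp_ofBits (u v : List Bool) :
    revApp (ofBits u) (ofBits v) = ofBits (u.reverse ++ v) := by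
  induction u generalizing v with
  | nil => rfl
  | cons b u ih =>
    have : revApp (ofBits (b :: u)) (ofBits v) = revApp (ofBits u) (ofBits (b :: v)) := rfl
    rw [this, ih]; simp

/-- The height of a tree. It bounds the lengths of all lists in the tree. -/
def height : Cell → ℕ
  | nil => 0
  | cons a b => max a.height b.height + 1

@[simp] theorem height_nil : nil.height = 0 := rfl

@[simp] theorem height_cons (a b : Cell) :
    (cons a b).height = max a.height b.height + 1 := rfl

theorem height_fst_le (c : Cell) : c.fst.height ≤ c.height := by
  cases c
  · simp
  · simp; omega

theorem height_snd_le (c : Cell) : c.snd.height ≤ c.height := by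
  cases c
  · simp
  · simp; omega

theorem length_toBits_le_height (c : Cell) : c.toBits.length ≤ c.height := by
  induction c with
  | nil => simp
  | cons a b _ ih => simp; omega

theorem height_ofBits_le (l : List Bool) : (ofBits l).height ≤ l.length + 1 := by
  induction l with
  | nil => simp [ofBits]
  | cons b l ih => cases b <;> simp [ofBits, ofBit] <;> omega

/-! ### The value of a binary numeral -/

/-- The number with binary digits `l`, least significant digit in front. -/
def bitsVal (l : List Bool) : ℕ :=
  l.foldr (fun b n => 2 * n + b.toNat) 0

@[simp] theorem bitsVal_nil : bitsVal [] = 0 := rfl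

@[simp] theorem bitsVal_cons (b : Bool) (l : List Bool) :
    bitsVal (b :: l) = 2 * bitsVal l + b.toNat := rfl

theorem toNat_eq_bitsVal (c : Cell) : c.toNat = bitsVal c.toBits := rfl

theorem bitsVal_bits (n : ℕ) : bitsVal n.bits = n := by
  induction n using Nat.binaryRec' with
  | zero => simp
  | bit b n h ih =>
    rw [Nat.bits_append_bit n b h, bitsVal_cons, ih]
    cases b <;> simp [Nat.bit]

theorem bitsVal_replicate_append (j : ℕ) (l : List Bool) :
    bitsVal (List.replicate j false ++ l) = 2 ^ j * bitsVal l := by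
  induction j with
  | zero => simp
  | succ j ih => simp [List.replicate_succ, ih, pow_succ]; ring

theorem bits_two_pow (j : ℕ) : (2 ^ j : ℕ).bits = List.replicate j false ++ [true] := by
  induction j with
  | zero => simp
  | succ j ih =>
    rw [pow_succ, mul_comm, Nat.bit0_bits _ (by positivity), ih]; rfl

theorem toRat_ofRat (r : ℚ≥0) : (ofRat r).toRat = r := by
  simp [ofRat, toRat, toNat_eq_bitsVal, bitsVal_bits, NNRat.num_div_den]

@[simp] theorem toRat_nil : nil.toRat = 0 := by
  simp [toRat, toNat_eq_bitsVal]

theorem ofRat_ne_nil (r : ℚ≥0) : ofRat r ≠ nil := by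
  simp [ofRat]

theorem ofRat_zero : ofRat 0 = cons nil (cons one nil) := by
  simp [ofRat, ofBits, ofBit, one]

theorem num_inv_two_pow (j : ℕ) : ((2 ^ j : ℚ≥0)⁻¹).num = 1 := by
  have h := Rat.inv_natCast_num_of_pos (a := 2 ^ j) (by positivity)
  rw [← NNRat.natAbs_num_coe]
  push_cast at h ⊢
  rw [h]; rfl

theorem den_inv_two_pow (j : ℕ) : ((2 ^ j : ℚ≥0)⁻¹).den = 2 ^ j := by
  have h := Rat.inv_natCast_den_of_pos (a := 2 ^ j) (by positivity)
  rw [← NNRat.den_coe]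
  push_cast at h ⊢
  rw [h]

theorem ofRat_inv_two_pow (j : ℕ) :
    ofRat (2 ^ j)⁻¹ = cons (cons one nil) (ofBits (List.replicate j false ++ [true])) := by
  rw [ofRat, num_inv_two_pow, den_inv_two_pow, bits_two_pow, Nat.one_bits]; rfl

theorem ratLength_inv_two_pow (j : ℕ) : ratLength (2 ^ j)⁻¹ = j + 2 := by
  rw [ratLength, num_inv_two_pow, den_inv_two_pow, bits_two_pow, Nat.one_bits]
  simp; omega

/-! ### Tries: finite maps from strings to trees -/

/-- The entry at the string `z` of a trie. A node of a trie consists of the entry and of the pair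
of its two children, the child for `0` in front; a missing entry is `nil`. -/
def lookup : Cell → List Bool → Cell
  | T, [] => T.fst
  | T, b :: z => lookup (if b = true then T.snd.snd else T.snd.fst) z

/-- Replace the entry at the string `z` of a trie by `v`. -/
def insert : Cell → List Bool → Cell → Cell
  | T, [], v => cons v T.snd
  | T, b :: z, v =>
    let U := insert (if b = true then T.snd.snd else T.snd.fst) z v
    cons T.fst (if b = true then cons T.snd.fst U else cons U T.snd.snd)

@[simp] theorem lookup_nil (z : List Bool) : lookup nil z = nil := by
  induction z with
  | nil => rfl
  | cons b z ih => simp [lookup, ih]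

theorem lookup_insert (T : Cell) (z z' : List Bool) (v : Cell) :
    lookup (insert T z v) z' = if z' = z then v else lookup T z' := by
  induction z generalizing T z' with
  | nil => cases z' <;> simp [insert, lookup]
  | cons b z ih =>
    cases z' with
    | nil => simp [insert, lookup]
    | cons b' z' => cases b <;> cases b' <;> simp [insert, lookup, ih]

@[simp] theorem lookup_insert_self (T : Cell) (z : List Bool) (v : Cell) :
    lookup (insert T z v) z = v := by
  simp [lookup_insert]

end Cell

/-! ### Interpreting programs that are given as trees -/

/-- The state of the interpreter: the list of the codes of the programs that remain to be
executed, the registers as a trie in which register `i` has the name `1^i`, and the table of the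
oracle answers that have been fixed, as a trie. -/
structure Interp where
  code : Cell
  store : Cell
  table : Cell

namespace Interp

open Cell

/-- Code of an instruction. The tag `v` says which value is computed, the tag `k` how the list of
the remaining programs changes; `x` is the register that receives the value, `y` and `z` are the
registers that are read, `p` and `q` are subprograms. -/
def instr (v k : ℕ) (x y z : ℕ) (p q : Cell) : Cell :=
  .cons (unary v) (.cons (unary k) (.cons (ofBits (List.replicate x true))
    (.cons (ofBits (List.replicate y true)) (.cons (ofBits (List.replicate z true))
      (.cons p q)))))

/-- Code of a program. The control instructions write a register back to itself, so that all
instructions have the same format. -/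
def encode : Prog → Cell
  | .clear x => instr 1 0 x x x nil nil
  | .copy x y => instr 0 0 x y y nil nil
  | .cons x y z => instr 2 0 x y z nil nil
  | .fst x y => instr 3 0 x y y nil nil
  | .snd x y => instr 4 0 x y y nil nil
  | .query x y => instr 5 0 x y y nil nil
  | .seq p q => instr 0 1 0 0 0 (encode p) (encode q)
  | .ite x p q => instr 0 2 x x x (encode p) (encode q)
  | .loop x p => instr 0 3 x x x (encode p) nil

/-- The value computed by an instruction with value tag `t`, if the registers that it reads hold
`y` and `z`, and the oracle answers `a`. -/
def value (t y z a : Cell) : Cell :=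
  if t.isCons = true then
    if t.snd.isCons = true then
      if t.snd.snd.isCons = true then
        if t.snd.snd.snd.isCons = true then
          if t.snd.snd.snd.snd.isCons = true then a else y.snd
        else y.fst
      else .cons y z
    else nil
  else y

/-- The programs that remain after the instruction `I`, with `p` and `q` its subprograms, if its
control tag is `t`, the register that it reads holds `y`, and `K` remained besides `I`. -/
def next (t I p q y K : Cell) : Cell :=
  if t.isCons = true then
    if t.snd.isCons = true then
      if t.snd.snd.isCons = true then
        if y.isCons = true then .cons p (.cons I K) else K
      else .cons (if y.isCons = true then p else q) K
    else .cons p (.cons q K)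
  else K

/-- The oracle answer that the table `T` fixes for `z`; if there is none, the answer will be
`0`. -/
def answer (T : Cell) (z : List Bool) : Cell :=
  if (lookup T z).isCons = true then lookup T z else .cons nil (.cons one nil)

/-- One step of the interpreter. In every step the oracle answer for the string in the register
`y` is fixed, whether it is asked for or not. If no program remains, then the step does what the
instruction `nil` says: it changes at most the table. -/
def step (S : Interp) : Interp :=
  let I := S.code.fst
  let y := lookup S.store I.snd.snd.snd.fst.toBits
  let z := lookup S.store I.snd.snd.snd.snd.fst.toBits
  let a := answer S.table y.toBits
  { code := next I.snd.fst I I.snd.snd.snd.snd.snd.fst I.snd.snd.snd.snd.snd.snd y S.code.snd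
    store := insert S.store I.snd.snd.fst.toBits (value I.fst y z a)
    table := insert S.table y.toBits a }

/-- The interpreter with program `p` and inputs `x` and `d`, before its first step. -/
def start (p x d T : Cell) : Interp where
  code := .cons p nil
  store := .cons x (.cons nil (.cons d nil))
  table := T

/-- The state of the interpreter corresponds to the configuration `C`. -/
def Represents (S : Interp) (C : Prog.Config) : Prop :=
  S.code = ofList (C.1.map encode) ∧ ∀ i, lookup S.store (List.replicate i true) = C.2 i

theorem represents_start (p : Prog) (x d T : Cell) :
    (start (encode p) x d T).Represents (Prog.init p x d) := by
  refine ⟨rfl, fun i => ?_⟩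
  match i with
  | 0 => rfl
  | 1 => rfl
  | i + 2 => simp [start, lookup, List.replicate_succ, Prog.init]

/-- All answers that the table fixes are those of the oracle `o`. -/
def Consistent (o : List Bool → ℚ≥0) (T : Cell) : Prop :=
  ∀ z, lookup T z ≠ nil → lookup T z = ofRat (o z)

theorem answer_ne_nil (T : Cell) (z : List Bool) : answer T z ≠ nil := by
  unfold answer
  split_ifs with h
  · exact isCons_iff_ne_nil.1 h
  · simp

theorem replicate_true_inj {i j : ℕ} :
    List.replicate i true = List.replicate j true ↔ i = j :=
  ⟨fun h => by simpa using congrArg List.length h, fun h => by rw [h]⟩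

/-- The interpreter simulates the machine with oracle `o`, as long as its table never fixes an
answer that differs from that of `o`. -/
theorem represents_step {o : List Bool → ℚ≥0} {S : Interp} {C : Prog.Config}
    (h : S.Represents C) (ho : Consistent o S.step.table) :
    S.step.Represents (Prog.step o C) := by
  obtain ⟨K, σ⟩ := C
  obtain ⟨hK, hσ⟩ := h
  simp only at hK hσ
  have store_step : ∀ x v i, lookup (insert S.store (List.replicate x true) v)
      (List.replicate i true) = Function.update σ x v i := by
    intro x v i
    rw [lookup_insert, hσ, Function.update_apply]
    simp only [replicate_true_inj]
  have self : ∀ x i, Function.update σ x (σ x) i = σ i := by simp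
  match K with
  | [] =>
    refine ⟨by simp [step, hK, next, Prog.step], fun i => ?_⟩
    have := store_step 0 (σ 0) i
    have h0 : lookup S.store [] = σ 0 := hσ 0
    simpa [step, hK, value, Prog.step, h0] using this
  | .query x y :: K =>
    refine ⟨by simp [step, hK, next, Prog.step, encode, instr, unary], fun i => ?_⟩
    have := ho (σ y).toBits
    simp only [step, hK, List.map_cons, ofList_cons, fst_cons, snd_cons, encode, instr,
      toBits_ofBits, hσ, lookup_insert_self, answer_ne_nil, ne_eq, not_false_eq_true,
      forall_const] at this
    simp [step, hK, encode, instr, unary, value, hσ, store_step, this, Prog.step]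
  | .clear x :: K | .copy x y :: K | .cons x y z :: K | .fst x y :: K | .snd x y :: K =>
    exact ⟨by simp [step, hK, next, Prog.step, encode, instr, unary],
      fun i => by simp [step, hK, encode, instr, unary, value, hσ, store_step, Prog.step]⟩
  | .seq p q :: K =>
    refine ⟨by simp [step, hK, next, Prog.step, encode, instr, unary], fun i => ?_⟩
    have := store_step 0 (σ 0) i
    have h0 : lookup S.store [] = σ 0 := hσ 0
    simpa [step, hK, encode, instr, unary, value, Prog.step, ofBits, h0] using this
  | .ite x p q :: K =>
    refine ⟨?_, fun i => by simp [step, hK, encode, instr, unary, value, hσ, store_step, Prog.step]⟩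
    by_cases hx : (σ x).isCons = true <;>
      simp [step, hK, next, Prog.step, encode, instr, unary, hσ, hx]
  | .loop x p :: K =>
    refine ⟨?_, fun i => by simp [step, hK, encode, instr, unary, value, hσ, store_step, Prog.step]⟩
    by_cases hx : (σ x).isCons = true <;>
      simp [step, hK, next, Prog.step, encode, instr, unary, hσ, hx]

theorem represents_iterate {o : List Bool → ℚ≥0} {S : Interp} {C : Prog.Config}
    (h : S.Represents C) (t : ℕ) (ho : ∀ j ≤ t, Consistent o (step^[j] S).table) :
    (step^[t] S).Represents ((Prog.step o)^[t] C) := by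
  induction t with
  | zero => exact h
  | succ t ih =>
    rw [Function.iterate_succ_apply', Function.iterate_succ_apply']
    refine represents_step (ih fun j hj => ho j (by omega)) ?_
    rw [← Function.iterate_succ_apply' step]
    exact ho _ le_rfl

/-! ### Bounds for the sizes of the trees in the interpreter -/

/-- Bounds for the trees in the interpreter: `h` for the codes and the contents of the registers,
`H` for the entries of the table. -/
structure Bounded (S : Interp) (h H : ℕ) : Prop where
  code : S.code.height ≤ h
  store : ∀ z, (lookup S.store z).height ≤ h
  table : ∀ z, (lookup S.table z).height ≤ H

/-- A step builds at most two new cells on top of the trees that are there; the entries of the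
table that it adds are answers `0`, of height `3`. -/
theorem Bounded.step {S : Interp} {h H : ℕ} (hS : S.Bounded h H) (hH : H ≤ h) (h2 : 3 ≤ H) :
    S.step.Bounded (h + 2) H := by
  have ha : ∀ z, (answer S.table z).height ≤ H := by
    intro z
    unfold answer
    split_ifs
    · exact hS.table z
    · simpa [one] using h2
  have hI := (height_fst_le S.code).trans hS.code
  have hs := fun c => height_snd_le c
  have hf := fun c => height_fst_le c
  refine ⟨?_, fun z => ?_, fun z => ?_⟩
  · have h1 := (hs S.code).trans hS.code
    have h3 := (hs S.code.fst).trans hI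
    have h4 := (hs _).trans h3
    have h5 := (hs _).trans h4
    have h6 := (hs _).trans h5
    have h7 := (hs _).trans h6
    have h8 := (hs _).trans h7
    have h9 := (hf _).trans h7
    simp only [Interp.step, next]
    split_ifs <;> (try simp only [height_cons]) <;> omega
  · simp only [Interp.step, lookup_insert]
    split_ifs
    · simp only [value]
      have h1 := hS.store S.code.fst.snd.snd.snd.fst.toBits
      have h2 := hS.store S.code.fst.snd.snd.snd.snd.fst.toBits
      have h3 := (hf _).trans h1
      have h4 := (hs _).trans h1
      have h5 := ha (lookup S.store S.code.fst.snd.snd.snd.fst.toBits).toBits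
      split_ifs <;> (try simp only [height_cons, height_nil]) <;> omega
    · exact (hS.store z).trans (by omega)
  · simp only [Interp.step, lookup_insert]
    split_ifs
    · exact ha _
    · exact hS.table z

theorem Bounded.iterate {S : Interp} {h H : ℕ} (hS : S.Bounded h H) (hH : H ≤ h) (h2 : 3 ≤ H)
    (j : ℕ) : (Interp.step^[j] S).Bounded (h + 2 * j) H := by
  induction j with
  | zero => exact hS
  | succ j ih =>
    rw [Function.iterate_succ_apply']
    exact ih.step (by omega) h2

end Interp

/-! ### Enumerating strings and programs -/

/-- From a list of strings, the list of the strings obtained by putting a bit in front. -/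
def double (l : List (List Bool)) : List (List Bool) :=
  l.foldl (fun acc v => (false :: v) :: (true :: v) :: acc) []

theorem double_aux (l acc : List (List Bool)) :
    (∀ v, v ∈ l.foldl (fun acc v => (false :: v) :: (true :: v) :: acc) acc ↔
      v ∈ acc ∨ ∃ b, ∃ w ∈ l, v = b :: w) ∧
    (l.foldl (fun acc v => (false :: v) :: (true :: v) :: acc) acc).length =
      acc.length + 2 * l.length := by
  induction l generalizing acc with
  | nil => simp
  | cons w l ih =>
    obtain ⟨h1, h2⟩ := ih ((false :: w) :: (true :: w) :: acc)
    refine ⟨fun v => ?_, ?_⟩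
    · rw [List.foldl_cons, h1]
      simp only [List.mem_cons, Bool.exists_bool]
      aesop
    · rw [List.foldl_cons, h2]
      simp only [List.length_cons]; omega

theorem mem_double {l : List (List Bool)} {v : List Bool} :
    v ∈ double l ↔ ∃ b, ∃ w ∈ l, v = b :: w := by
  simpa [double] using (double_aux l []).1 v

theorem length_double (l : List (List Bool)) : (double l).length = 2 * l.length := by
  simpa [double] using (double_aux l []).2

/-- A list of all strings of length `j`. -/
def strings (j : ℕ) : List (List Bool) :=
  double^[j] [[]]

theorem strings_succ (j : ℕ) : strings (j + 1) = double (strings j) :=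
  Function.iterate_succ_apply' _ _ _

theorem iterate_double_strings (i j : ℕ) : double^[i] (strings j) = strings (i + j) := by
  rw [strings, ← Function.iterate_add_apply, strings]

theorem mem_strings {j : ℕ} {v : List Bool} : v ∈ strings j ↔ v.length = j := by
  induction j generalizing v with
  | zero => simp [strings]
  | succ j ih =>
    rw [strings_succ, mem_double]
    cases v with
    | nil => simp
    | cons b v => simp [ih]

theorem length_strings (j : ℕ) : (strings j).length = 2 ^ j := by
  induction j with
  | zero => rfl
  | succ j ih => rw [strings_succ, length_double, ih, pow_succ]; ring

/-- One step of the stack machine that reads a string as the postfix notation of a tree: the bit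
`0` pushes `nil`, the bit `1` replaces the two topmost trees by their pair. -/
def pushBit (s : Cell) (b : Bool) : Cell :=
  if b = true then .cons (.cons s.snd.fst s.fst) s.snd.snd else .cons .nil s

/-- The tree with postfix notation `v`. -/
def decode (v : List Bool) : Cell :=
  (v.foldl pushBit .nil).fst

theorem exists_postfix (c : Cell) : ∃ v : List Bool, ∀ s, v.foldl pushBit s = .cons c s := by
  induction c with
  | nil => exact ⟨[false], fun s => rfl⟩
  | cons a b iha ihb =>
    obtain ⟨u, hu⟩ := iha
    obtain ⟨v, hv⟩ := ihb
    exact ⟨u ++ (v ++ [true]), fun s => by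
      simp [List.foldl_append, hu, hv, pushBit]⟩

/-- Every tree has codes of all large lengths: padding with `0`s in front only pushes trees that are
never used. -/
theorem eventually_exists_decode (c : Cell) : ∀ᶠ k : ℕ in atTop, ∃ v ∈ strings k, decode v = c := by
  obtain ⟨v, hv⟩ := exists_postfix c
  filter_upwards [eventually_ge_atTop v.length] with k hk
  refine ⟨List.replicate (k - v.length) false ++ v, mem_strings.2 (by simp; omega), ?_⟩
  simp [decode, List.foldl_append, hv]

theorem height_foldl_pushBit_le (v : List Bool) (s : Cell) :
    (v.foldl pushBit s).height ≤ s.height + 2 * v.length := by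
  induction v generalizing s with
  | nil => simp
  | cons b v ih =>
    have h1 := Cell.height_snd_le s
    have h2 := Cell.height_fst_le s
    have h3 := (Cell.height_fst_le s.snd).trans h1
    have h4 := (Cell.height_snd_le s.snd).trans h1
    have := ih (pushBit s b)
    have h5 : (pushBit s b).height ≤ s.height + 2 := by
      unfold pushBit
      split_ifs <;> simp only [Cell.height_cons, Cell.height_nil] <;> omega
    simp only [List.foldl_cons, List.length_cons]
    omega

theorem height_decode_le (v : List Bool) : (decode v).height ≤ 2 * v.length := by
  have := height_foldl_pushBit_le v .nil
  have h := Cell.height_fst_le (v.foldl pushBit .nil)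
  simp only [Cell.height_nil] at this
  unfold decode
  omega

/-! ### The diagonal estimator -/

/-- The rates of the construction: strings of length `m` have level `k = m / D`; the last `a * k`
bits of a string are free, and a simulation takes less than `2 ^ (b * k)` steps. -/
structure Rates where
  D : ℕ
  a : ℕ
  b : ℕ

open Cell

namespace Rates

variable (P : Rates)

/-- The level of strings of length `m`. There are `2 ^ level` programs that are simulated. -/
def level (m : ℕ) : ℕ := m / P.D

/-- The number of steps of a simulation. It vanishes at level `0`. -/
def clock (m : ℕ) : ℕ := 2 ^ (P.b * P.level m) - 1

/-- The number of the bits that are chosen such that a string is fresh. -/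
def free (m : ℕ) : ℕ := P.a * P.level m

/-- The number of the bits that are chosen against the simulated program. -/
def bound (m : ℕ) : ℕ := m - P.free m

/-- The precision `2 ^ (-bound)` that is asked for in the simulations. -/
def precision (m : ℕ) : ℚ≥0 := (2 ^ P.bound m)⁻¹

/-- The probability `2 ^ (-level)` of a string in the support. -/
def weight (m : ℕ) : ℚ≥0 := (2 ^ P.level m)⁻¹

/-- The simulation of the program with code `p` for the approximate value at `w0`. -/
def simulate (m : ℕ) (p : Cell) (w : List Bool) (T : Cell) : Interp :=
  Interp.step^[P.clock m] (Interp.start p (ofBits (w ++ [false])) (ofRat (P.precision m)) T)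

/-- The output `c` denotes a number that is at most `2 ^ (-j)`. -/
def isLow (j : ℕ) (c : Cell) : Bool :=
  decide (c.toRat ≤ (2 ^ j)⁻¹)

/-- One step of the greedy choice: the string is prolonged by `0` if the simulated program
considers that child as unlikely, and by `1` otherwise. The table is passed on. -/
def greedyStep (m : ℕ) (p : Cell) (S : List Bool × Cell) : List Bool × Cell :=
  (S.1 ++ [!isLow (S.1.length + 1) (P.simulate m p S.1 S.2).store.fst],
    (P.simulate m p S.1 S.2).table)

/-- A string of length `bound m` that the program `p` considers as unlikely, and the table after
the simulations. -/
def greedy (m : ℕ) (p T : Cell) : List Bool × Cell :=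
  (P.greedyStep m p)^[P.bound m] ([], T)

/-- The last of the strings `w ++ y`, with `y` in the list `l`, that is not in the table `T`. -/
def fresh (T : Cell) (w : List Bool) (l : List (List Bool)) : List Bool :=
  l.foldl (fun f y => if (lookup T (w ++ y)).isCons = true then f else w ++ y) []

/-- The table after the string of length `m` for the program with postfix notation `v` has been
put into the support. -/
def addProgram (m : ℕ) (T : Cell) (v : List Bool) : Cell :=
  insert (P.greedy m (decode v) T).2
    (fresh (P.greedy m (decode v) T).2 (P.greedy m (decode v) T).1 (strings (P.free m)))
    (ofRat (P.weight m))

/-- The table after all strings of length `m` in the support have been chosen. -/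
def stage (m : ℕ) (T : Cell) : Cell :=
  (strings (P.level m)).foldl (P.addProgram m) T

/-- The table after the stages `0, …, n - 1`. -/
def table : ℕ → Cell
  | 0 => nil
  | n + 1 => P.stage n (table n)

/-- The diagonal estimator. -/
def estimator (x : List Bool) : ℚ≥0 :=
  (lookup (P.table (x.length + 1)) x).toRat

/-! ### Growth of the table -/

/-- The entries of `T` persist in `T'`, and all new entries are `0`. -/
def Freezes (T T' : Cell) : Prop :=
  ∀ z, lookup T' z = lookup T z ∨ (lookup T z = nil ∧ lookup T' z = ofRat 0)

/-- The entries of `T` persist in `T'`, and all new entries are `0` or, at strings of length `m`,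
the weight of stage `m`. -/
def Extends (m : ℕ) (T T' : Cell) : Prop :=
  ∀ z, lookup T' z = lookup T z ∨ (lookup T z = nil ∧
    (lookup T' z = ofRat 0 ∨ z.length = m ∧ lookup T' z = ofRat (P.weight m)))

/-- The entries of `T` persist in `T'`. -/
def Persists (T T' : Cell) : Prop :=
  ∀ z, lookup T z ≠ nil → lookup T' z = lookup T z

variable {P}

theorem Freezes.refl (T : Cell) : Freezes T T := fun _ => .inl rfl

theorem Freezes.trans {T T' T'' : Cell} (h : Freezes T T') (h' : Freezes T' T'') :
    Freezes T T'' := by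
  intro z
  rcases h z with h | ⟨h, h0⟩ <;> rcases h' z with h' | ⟨h', h0'⟩
  · exact .inl (h'.trans h)
  · exact .inr ⟨h.symm.trans h', h0'⟩
  · exact .inr ⟨h, h'.trans h0⟩
  · exact absurd (h0.symm.trans h') (ofRat_ne_nil _)

theorem Freezes.extends {T T' : Cell} (m : ℕ) (h : Freezes T T') : P.Extends m T T' := by
  intro z
  rcases h z with h | ⟨h, h0⟩
  · exact .inl h
  · exact .inr ⟨h, .inl h0⟩

theorem Extends.persists {m : ℕ} {T T' : Cell} (h : P.Extends m T T') : Persists T T' := by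
  intro z hz
  rcases h z with h | ⟨h, -⟩
  · exact h
  · exact absurd h hz

theorem Extends.refl (m : ℕ) (T : Cell) : P.Extends m T T := fun _ => .inl rfl

theorem Extends.trans {m : ℕ} {T T' T'' : Cell} (h : P.Extends m T T') (h' : P.Extends m T' T'') :
    P.Extends m T T'' := by
  intro z
  rcases h z with h0 | ⟨h0, h1⟩
  · rcases h' z with h2 | ⟨h2, h3⟩
    · exact .inl (h2.trans h0)
    · exact .inr ⟨h0.symm.trans h2, h3⟩
  · have hz : lookup T' z ≠ nil := by
      rcases h1 with h1 | ⟨-, h1⟩ <;> rw [h1] <;> exact ofRat_ne_nil _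
    have := h'.persists z hz
    exact .inr ⟨h0, by rwa [this]⟩

theorem Persists.refl (T : Cell) : Persists T T := fun _ _ => rfl

theorem Persists.trans {T T' T'' : Cell} (h : Persists T T') (h' : Persists T' T'') :
    Persists T T'' := by
  intro z hz
  rw [h' z (by rwa [h z hz]), h z hz]

theorem freezes_step (S : Interp) : Freezes S.table S.step.table := by
  intro z
  simp only [Interp.step, lookup_insert]
  split_ifs with h
  · subst h
    unfold Interp.answer
    split_ifs with h
    · exact .inl rfl
    · exact .inr ⟨by rwa [isCons_iff_ne_nil, not_not] at h, ofRat_zero.symm⟩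
  · exact .inl rfl

theorem freezes_iterate (S : Interp) (j : ℕ) : Freezes S.table (Interp.step^[j] S).table := by
  induction j with
  | zero => exact .refl _
  | succ j ih =>
    rw [Function.iterate_succ_apply']
    exact ih.trans (freezes_step _)

theorem freezes_simulate (m : ℕ) (p : Cell) (w : List Bool) (T : Cell) :
    Freezes T (P.simulate m p w T).table :=
  freezes_iterate (Interp.start p (ofBits (w ++ [false])) (ofRat (P.precision m)) T) _

theorem freezes_greedyStep (m : ℕ) (p : Cell) (S : List Bool × Cell) (j : ℕ) :
    Freezes S.2 ((P.greedyStep m p)^[j] S).2 := by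
  induction j with
  | zero => exact .refl _
  | succ j ih =>
    rw [Function.iterate_succ_apply']
    exact ih.trans (freezes_simulate _ _ _ _)

theorem length_greedyStep (m : ℕ) (p : Cell) (S : List Bool × Cell) (j : ℕ) :
    ((P.greedyStep m p)^[j] S).1.length = S.1.length + j := by
  induction j with
  | zero => rfl
  | succ j ih =>
    rw [Function.iterate_succ_apply', greedyStep, List.length_append, ih]; rfl

theorem length_greedy (m : ℕ) (p T : Cell) : (P.greedy m p T).1.length = P.bound m := by
  simp [greedy, length_greedyStep]

theorem free_le (ha : P.a ≤ P.D) (m : ℕ) : P.free m ≤ m :=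
  (Nat.mul_le_mul_right _ ha).trans (Nat.mul_div_le m P.D)

theorem bound_add_free (ha : P.a ≤ P.D) (m : ℕ) : P.bound m + P.free m = m :=
  Nat.sub_add_cancel (free_le ha m)

/-! ### Fresh strings exist -/

/-- The strings of length `s`. -/
def cube (s : ℕ) : Finset (List Bool) :=
  Finset.univ.map ⟨fun x : Fin s → Bool => List.ofFn x, List.ofFn_injective⟩

theorem mem_cube {s : ℕ} {x : List Bool} : x ∈ cube s ↔ x.length = s := by
  simp only [cube, Finset.mem_map, Finset.mem_univ, true_and, Function.Embedding.coeFn_mk]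
  constructor
  · rintro ⟨y, rfl⟩; simp
  · rintro rfl; exact ⟨x.get, List.ofFn_get x⟩

theorem card_cube (s : ℕ) : (cube s).card = 2 ^ s := by
  simp [cube]

open Classical in
/-- The number of the strings of length `s` in the table. -/
noncomputable def count (s : ℕ) (T : Cell) : ℕ :=
  ((cube s).filter fun x => lookup T x ≠ nil).card

theorem count_nil (s : ℕ) : count s nil = 0 := by
  simp [count]

theorem count_insert_le (s : ℕ) (T : Cell) (z : List Bool) (v : Cell) :
    count s (insert T z v) ≤ count s T + 1 := by
  classical
  refine (Finset.card_le_card (t := Insert.insert z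
    ((cube s).filter fun x => lookup T x ≠ nil)) ?_).trans (Finset.card_insert_le _ _)
  intro x hx
  simp only [Finset.mem_filter, lookup_insert, Finset.mem_insert] at hx ⊢
  by_cases h : x = z
  · exact .inl h
  · exact .inr (by simpa [h] using hx)

theorem count_insert_of_ne {s : ℕ} {z : List Bool} (h : z.length ≠ s) (T v : Cell) :
    count s (insert T z v) = count s T := by
  classical
  unfold count
  congr 1
  refine Finset.filter_congr fun x hx => ?_
  rw [lookup_insert, if_neg]
  rintro rfl
  exact h (mem_cube.1 hx)

theorem count_iterate_le (s : ℕ) (S : Interp) (j : ℕ) :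
    count s (Interp.step^[j] S).table ≤ count s S.table + j := by
  induction j with
  | zero => simp
  | succ j ih =>
    rw [Function.iterate_succ_apply']
    exact (count_insert_le _ _ _ _).trans (by omega)

theorem count_greedy_le (s m : ℕ) (p T : Cell) :
    count s (P.greedy m p T).2 ≤ count s T + P.bound m * P.clock m := by
  have : ∀ j, count s ((P.greedyStep m p)^[j] ([], T)).2 ≤ count s T + j * P.clock m := by
    intro j
    induction j with
    | zero => simp
    | succ j ih =>
      rw [Function.iterate_succ_apply']
      refine (count_iterate_le s _ _).trans ?_
      rw [Nat.add_mul, one_mul, ← add_assoc]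
      exact Nat.add_le_add_right ih _
  exact this _

theorem fresh_spec {T : Cell} {w : List Bool} {l : List (List Bool)}
    (h : ∃ y ∈ l, lookup T (w ++ y) = nil) :
    lookup T (fresh T w l) = nil ∧ ∃ y ∈ l, fresh T w l = w ++ y := by
  unfold fresh
  induction l using List.reverseRecOn with
  | nil => simp at h
  | append_singleton l y ih =>
    rw [List.foldl_append, List.foldl_cons, List.foldl_nil]
    split_ifs with hy
    · rw [isCons_iff_ne_nil] at hy
      have : ∃ y ∈ l, lookup T (w ++ y) = nil := by
        obtain ⟨y', hy', h0⟩ := h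
        rcases List.mem_append.1 hy' with h1 | h1
        · exact ⟨y', h1, h0⟩
        · rw [List.mem_singleton.1 h1] at h0
          exact absurd h0 hy
      obtain ⟨h1, y', h2, h3⟩ := ih this
      exact ⟨h1, y', by simp [h2], h3⟩
    · rw [isCons_iff_ne_nil, not_not] at hy
      exact ⟨hy, y, by simp, rfl⟩

theorem exists_fresh {T : Cell} {w : List Bool} {j : ℕ} (h : count (w.length + j) T < 2 ^ j) :
    ∃ y ∈ strings j, lookup T (w ++ y) = nil := by
  classical
  by_contra! hne
  refine h.not_ge ?_
  rw [← card_cube j, count]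
  refine Finset.card_le_card_of_injOn (fun y => w ++ y) (fun y hy => ?_)
    (fun y _ z _ h => List.append_cancel_left h)
  have hy' := mem_cube.1 hy
  simp [mem_cube, hy', hne y (mem_strings.2 hy')]

/-- The conditions under which the stages succeed. By `count`, the answers that are fixed in the
stages up to `m`, together with the `2 ^ level m` strings of stage `m`, do not exhaust the
`2 ^ free m` strings of length `m` with a given beginning. -/
structure Good (P : Rates) : Prop where
  pos : 0 < P.D
  free_le : P.a ≤ P.D
  count : ∀ m, (m + 1) * (2 ^ P.level m * (m * P.clock m)) + 2 ^ P.level m ≤ 2 ^ P.free m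

theorem level_mono {i j : ℕ} (h : i ≤ j) : P.level i ≤ P.level j :=
  Nat.div_le_div_right h

theorem clock_mono {i j : ℕ} (h : i ≤ j) : P.clock i ≤ P.clock j :=
  Nat.sub_le_sub_right (Nat.pow_le_pow_right two_pos (Nat.mul_le_mul_left _ (level_mono h))) _

/-- What holds for a table `T` to which `j` programs have been added in stage `m`, having started
from the table `T₀`. -/
structure StageInv (P : Rates) (m : ℕ) (T₀ T : Cell) (j : ℕ) : Prop where
  ext : P.Extends m T₀ T
  mass : ∑ x ∈ cube m, (lookup T x).toRat = ∑ x ∈ cube m, (lookup T₀ x).toRat + j * P.weight m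
  count_self : count m T ≤ count m T₀ + j * (m * P.clock m + 1)
  count_ne : ∀ s ≠ m, count s T ≤ count s T₀ + j * (m * P.clock m)

theorem Freezes.toRat {T T' : Cell} (h : Freezes T T') (z : List Bool) :
    (lookup T' z).toRat = (lookup T z).toRat := by
  rcases h z with h | ⟨h, h0⟩
  · rw [h]
  · rw [h, h0, toRat_ofRat, toRat_nil]

theorem sum_insert {T : Cell} {x : List Bool} {s : ℕ} (hx : x.length = s)
    (h : lookup T x = nil) (v : Cell) :
    ∑ z ∈ cube s, (lookup (insert T x v) z).toRat =
      ∑ z ∈ cube s, (lookup T z).toRat + v.toRat := by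
  rw [← Finset.sum_erase_add _ _ (mem_cube.2 hx), ← Finset.sum_erase_add (cube s) _ (mem_cube.2 hx),
    h, lookup_insert_self, toRat_nil, add_zero]
  congr 1
  refine Finset.sum_congr rfl fun z hz => ?_
  rw [lookup_insert, if_neg (Finset.ne_of_mem_erase hz)]

theorem count_greedy_le_mul (m : ℕ) (p T : Cell) (s : ℕ) :
    count s (P.greedy m p T).2 ≤ count s T + m * P.clock m :=
  (count_greedy_le s m p T).trans
    (Nat.add_le_add_left (Nat.mul_le_mul_right _ (Nat.sub_le _ _)) _)

theorem freezes_greedy (m : ℕ) (p T : Cell) : Freezes T (P.greedy m p T).2 :=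
  freezes_greedyStep m p ([], T) _

/-- Adding a program puts a fresh string into the table that begins with the greedy string of the
program. -/
theorem addProgram_spec (hP : P.Good) {m : ℕ} {T : Cell} (v : List Bool)
    (h : count m T + m * P.clock m < 2 ^ P.free m) :
    ∃ y, ((P.greedy m (decode v) T).1 ++ y).length = m ∧
      lookup (P.greedy m (decode v) T).2 ((P.greedy m (decode v) T).1 ++ y) = nil ∧
      P.addProgram m T v = insert (P.greedy m (decode v) T).2
        ((P.greedy m (decode v) T).1 ++ y) (ofRat (P.weight m)) := by
  have hlen := bound_add_free hP.free_le m
  have hw := length_greedy (P := P) m (decode v) T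
  have := exists_fresh (T := (P.greedy m (decode v) T).2) (w := (P.greedy m (decode v) T).1)
    (j := P.free m) (by
      rw [hw, hlen]
      exact (count_greedy_le_mul m _ T m).trans_lt h)
  obtain ⟨h1, y, hy, h2⟩ := fresh_spec this
  refine ⟨y, ?_, h2 ▸ h1, ?_⟩
  · rw [List.length_append, hw, mem_strings.1 hy, hlen]
  · rw [addProgram, h2]

theorem extends_insert {m : ℕ} {T : Cell} {x : List Bool} (hx : x.length = m)
    (h : lookup T x = nil) : P.Extends m T (insert T x (ofRat (P.weight m))) := by
  intro z
  rw [lookup_insert]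
  split_ifs with hz
  · subst hz
    exact .inr ⟨h, .inr ⟨hx, rfl⟩⟩
  · exact .inl rfl

theorem StageInv.addProgram (hP : P.Good) {m : ℕ} {T₀ T : Cell} {j : ℕ}
    (hT : StageInv P m T₀ T j) (v : List Bool)
    (h : count m T + m * P.clock m < 2 ^ P.free m) :
    StageInv P m T₀ (P.addProgram m T v) (j + 1) := by
  obtain ⟨y, hy, h0, h1⟩ := addProgram_spec hP v h
  have hfr := freezes_greedy (P := P) m (decode v) T
  have hc := count_greedy_le_mul (P := P) m (decode v) T
  rw [h1]
  refine ⟨hT.ext.trans ((hfr.extends m).trans (extends_insert hy h0)), ?_, ?_, fun s hs => ?_⟩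
  · rw [sum_insert hy h0, Finset.sum_congr rfl fun z _ => hfr.toRat z, hT.mass, toRat_ofRat]
    push_cast; ring
  · have h2 := count_insert_le m (P.greedy m (decode v) T).2
      ((P.greedy m (decode v) T).1 ++ y) (ofRat (P.weight m))
    have h3 := hT.count_self
    have h4 := hc m
    rw [Nat.add_mul, one_mul]
    omega
  · rw [count_insert_of_ne (by rw [hy]; exact hs.symm)]
    have h3 := hT.count_ne s hs
    have h4 := hc s
    rw [Nat.add_mul, one_mul]
    omega

/-- All additions of programs within a stage succeed, and there is room for one more unless the
stage is over. -/
theorem stageInv_foldl (hP : P.Good) {m : ℕ} {T₀ : Cell}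
    (h₀ : count m T₀ ≤ m * (2 ^ P.level m * (m * P.clock m))) (l : List (List Bool))
    (hl : l.length ≤ 2 ^ P.level m) :
    StageInv P m T₀ (l.foldl (P.addProgram m) T₀) l.length ∧
    (l.length < 2 ^ P.level m →
      count m (l.foldl (P.addProgram m) T₀) + m * P.clock m < 2 ^ P.free m) := by
  have key : ∀ T : Cell, ∀ j, StageInv P m T₀ T j → j < 2 ^ P.level m →
      count m T + m * P.clock m < 2 ^ P.free m := by
    intro T j hT hj
    have h1 := hT.count_self
    have h2 := hP.count m
    have h3 : (j + 1) * (m * P.clock m) ≤ 2 ^ P.level m * (m * P.clock m) :=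
      Nat.mul_le_mul_right _ hj
    rw [Nat.add_mul, one_mul] at h2 h3
    rw [Nat.mul_add, mul_one] at h1
    omega
  suffices h : StageInv P m T₀ (l.foldl (P.addProgram m) T₀) l.length from
    ⟨h, key _ _ h⟩
  induction l using List.reverseRecOn with
  | nil => exact ⟨.refl _ _, by simp, by simp, by simp⟩
  | append_singleton l v ih =>
    rw [List.length_append, List.length_singleton] at hl ⊢
    rw [List.foldl_append, List.foldl_cons, List.foldl_nil]
    have := ih (by omega)
    exact this.addProgram hP v (key _ _ this (by omega))

/-- Before stage `n`, only answers that were fixed in simulations take up strings of length `s`, for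
`n ≤ s`; hence stage `n` succeeds. -/
theorem count_table_le (hP : P.Good) {s n : ℕ} (h : n ≤ s) :
    count s (P.table n) ≤ n * (2 ^ P.level s * (s * P.clock s)) ∧
    StageInv P n (P.table n) (P.table (n + 1)) (2 ^ P.level n) := by
  induction n using Nat.strong_induction_on generalizing s with
  | _ n ih =>
    have hc : ∀ s, n ≤ s → count s (P.table n) ≤ n * (2 ^ P.level s * (s * P.clock s)) := by
      intro s h
      cases n with
      | zero => simp [table, count_nil]
      | succ n =>
        obtain ⟨h1, h2⟩ := ih n (by omega) (show n ≤ s by omega)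
        have h3 := h2.count_ne s (by omega)
        have h4 : 2 ^ P.level n * (n * P.clock n) ≤ 2 ^ P.level s * (s * P.clock s) :=
          Nat.mul_le_mul (Nat.pow_le_pow_right two_pos (level_mono (by omega)))
            (Nat.mul_le_mul (by omega) (clock_mono (by omega)))
        rw [Nat.add_mul, one_mul]
        omega
    refine ⟨hc s h, ?_⟩
    have := (stageInv_foldl hP (hc n le_rfl) (strings (P.level n))
      (by rw [length_strings])).1
    rwa [length_strings] at this

theorem stageInv_table (hP : P.Good) (n : ℕ) :
    StageInv P n (P.table n) (P.table (n + 1)) (2 ^ P.level n) :=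
  (count_table_le hP (le_refl n)).2

/-! ### The estimator is the final table -/

theorem lookup_table_eq (hP : P.Good) (n : ℕ) (z : List Bool) :
    lookup (P.table n) z = nil ∨ lookup (P.table n) z = ofRat 0 ∨
      z.length < n ∧ lookup (P.table n) z = ofRat (P.weight z.length) := by
  induction n with
  | zero => simp [table]
  | succ n ih =>
    rcases (stageInv_table hP n).ext z with h | ⟨-, h | ⟨h1, h2⟩⟩
    · rw [h]
      rcases ih with ih | ih | ih
      · exact .inl ih
      · exact .inr (.inl ih)
      · exact .inr (.inr ⟨by omega, ih.2⟩)
    · exact .inr (.inl h)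
    · exact .inr (.inr ⟨by omega, by rw [h2, h1]⟩)

theorem persists_table (hP : P.Good) {n n' : ℕ} (h : n ≤ n') :
    Persists (P.table n) (P.table n') := by
  induction n', h using Nat.le_induction with
  | base => exact .refl _
  | succ n' _ ih => exact ih.trans (stageInv_table hP n').ext.persists

/-- The answers in the table are those of the estimator, at every stage: entries persist, and a
string without an entry after the stage of its length can only get the entry `0` later. -/
theorem consistent_table (hP : P.Good) (n : ℕ) : Interp.Consistent P.estimator (P.table n) := by
  intro z hz
  have hfix : ∀ n, lookup (P.table n) z = lookup (P.table (z.length + 1)) z →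
      lookup (P.table n) z ≠ nil → lookup (P.table n) z = ofRat (P.estimator z) := by
    intro n h hne
    rw [estimator, ← h]
    rcases lookup_table_eq hP n z with h | h | ⟨-, h⟩
    · exact absurd h hne
    · rw [h, toRat_ofRat]
    · rw [h, toRat_ofRat]
  rcases le_total n (z.length + 1) with h | h
  · exact hfix n (persists_table hP h z hz).symm hz
  · induction n, h using Nat.le_induction with
    | base => exact hfix _ rfl hz
    | succ n hn ih =>
      by_cases h0 : lookup (P.table n) z = nil
      · have hnil : lookup (P.table (z.length + 1)) z = nil := by
          by_contra hne
          exact hne ((persists_table hP hn z hne).symm.trans h0)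
        rcases (stageInv_table hP n).ext z with h | ⟨-, h | ⟨h1, -⟩⟩
        · exact absurd (h.trans h0) hz
        · rw [h, estimator, hnil, toRat_nil]
        · omega
      · rw [(stageInv_table hP n).ext.persists z h0, ih h0]

theorem lookup_table_length (hP : P.Good) (x : List Bool) :
    lookup (P.table x.length) x = nil ∨ lookup (P.table x.length) x = ofRat 0 := by
  rcases lookup_table_eq hP x.length x with h | h | ⟨h, -⟩
  · exact .inl h
  · exact .inr h
  · omega

theorem isOffline_estimator (hP : P.Good) : IsOffline P.estimator := by
  intro s
  have h := (stageInv_table hP s).mass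
  have h0 : ∑ x ∈ cube s, (lookup (P.table s) x).toRat = 0 := by
    refine Finset.sum_eq_zero fun x hx => ?_
    have hx := mem_cube.1 hx
    rcases lookup_table_length hP x with h | h <;> rw [hx] at h <;> rw [h]
    · exact toRat_nil
    · exact toRat_ofRat 0
  rw [h0, zero_add, weight] at h
  push_cast at h
  rw [mul_inv_cancel₀ (by positivity)] at h
  rw [← h, cube, Finset.sum_map]
  refine Finset.sum_congr rfl fun x _ => ?_
  simp [estimator]

/-! ### Diagonalization -/

theorem consistent_of_persists {o : List Bool → ℚ≥0} {T T' : Cell} (h : Persists T T')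
    (h' : Interp.Consistent o T') : Interp.Consistent o T := by
  intro z hz
  rw [← h z hz, h' z (by rwa [h z hz])]

theorem _root_.Prog.iterate_step_of_halted (o : List Bool → ℚ≥0) {C : Prog.Config} (h : C.1 = []) (t : ℕ) :
    (Prog.step o)^[t] C = C := by
  obtain ⟨K, σ⟩ := C
  simp only at h
  subst h
  induction t with
  | zero => rfl
  | succ t ih => rw [Function.iterate_succ_apply']; rw [ih]; rfl

theorem _root_.Prog.HaltsWithin.mono {o : List Bool → ℚ≥0} {p : Prog} {x d c : Cell} {t t' : ℕ}
    (h : p.HaltsWithin o x d t c) (ht : t ≤ t') : p.HaltsWithin o x d t' c := by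
  obtain ⟨j, rfl⟩ := Nat.exists_eq_add_of_le' ht
  rw [Prog.HaltsWithin, Function.iterate_add_apply, Prog.iterate_step_of_halted o h.1]
  exact h

/-- The simulation of a program that halts in time gives the output of the program with the
diagonal estimator as its oracle: the answers it got are never revised. -/
theorem simulate_eq (hP : P.Good) {m : ℕ} {p : Prog} {w : List Bool} {T c : Cell}
    (hT : Persists (P.simulate m (Interp.encode p) w T).table (P.table (m + 1)))
    (h : p.HaltsWithin P.estimator (ofBits (w ++ [false])) (ofRat (P.precision m))
      (P.clock m) c) :
    (P.simulate m (Interp.encode p) w T).store.fst = c := by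
  have := Interp.represents_iterate (o := P.estimator)
    (Interp.represents_start p (ofBits (w ++ [false])) (ofRat (P.precision m)) T)
    (P.clock m) fun j hj => by
      refine consistent_of_persists (Persists.trans ?_ hT) (consistent_table hP (m + 1))
      obtain ⟨i, hi⟩ := Nat.exists_eq_add_of_le' hj
      rw [simulate, hi, Function.iterate_add_apply]
      exact ((freezes_iterate _ i).extends (P := P) m).persists
  exact (this.2 0).trans h.2

/-- For every program and all large lengths `m`, there is a string in the support whose first
`bound m` bits are chosen greedily against the program, provided that the program is fast
enough. -/
theorem exists_diagonal (hP : P.Good) (p : Prog) : ∀ᶠ m : ℕ in atTop, ∀ c : List Bool → Cell,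
    (∀ w : List Bool, w.length < P.bound m →
      p.HaltsWithin P.estimator (ofBits (w ++ [false])) (ofRat (P.precision m))
        (P.clock m) (c w)) →
    ∃ x : List Bool, x.length = m ∧ P.estimator x = P.weight m ∧
      ∀ i < P.bound m, x.take (i + 1) = x.take i ++ [!isLow (i + 1) (c (x.take i))] := by
  have hlev : Tendsto P.level atTop atTop := Nat.tendsto_div_const_atTop hP.pos.ne'
  filter_upwards [hlev.eventually (eventually_exists_decode (Interp.encode p))] with m hm c hc
  obtain ⟨v, hv, hvp⟩ := hm
  obtain ⟨l₁, l₂, hl⟩ := List.append_of_mem hv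
  have hlen := length_strings (P.level m)
  rw [hl, List.length_append, List.length_cons] at hlen
  have hcount := (count_table_le hP (le_refl m)).1
  have hT₁ := (stageInv_foldl hP hcount l₁ (by omega)).2 (by omega)
  set T := l₁.foldl (P.addProgram m) (P.table m) with hT
  have htab : P.table (m + 1) = l₂.foldl (P.addProgram m) (P.addProgram m T v) := by
    rw [table, stage, hl, List.foldl_append, List.foldl_cons]
  have hsub : P.Extends m (P.addProgram m T v) (P.table (m + 1)) := by
    have : ∀ l : List (List Bool), l₁.length + 1 + l.length ≤ 2 ^ P.level m →
        P.Extends m (P.addProgram m T v) (l.foldl (P.addProgram m) (P.addProgram m T v)) := by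
      intro l hle
      induction l using List.reverseRecOn with
      | nil => exact .refl _ _
      | append_singleton l u ih =>
        rw [List.length_append, List.length_singleton] at hle
        have heq : l.foldl (P.addProgram m) (P.addProgram m T v) =
            (l₁ ++ v :: l).foldl (P.addProgram m) (P.table m) := by
          rw [List.foldl_append, List.foldl_cons]
        have h2 := (stageInv_foldl hP hcount (l₁ ++ v :: l) (by simp; omega)).2
          (by simp; omega)
        rw [← heq] at h2
        rw [List.foldl_append, List.foldl_cons, List.foldl_nil]
        obtain ⟨y, hy, h0, h1⟩ := addProgram_spec hP u h2
        rw [h1]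
        exact (ih (by omega)).trans
          (((freezes_greedy m _ _).extends m).trans (extends_insert hy h0))
    rw [htab]
    exact this l₂ (by omega)
  obtain ⟨y, hy, h0, h1⟩ := addProgram_spec hP v hT₁
  rw [hvp] at hy h0 h1
  set S := fun j => (P.greedyStep m (Interp.encode p))^[j] ([], T) with hS
  have hSlen : ∀ j, (S j).1.length = j := fun j => by simp [hS, length_greedyStep]
  have hgr : P.greedy m (Interp.encode p) T = S (P.bound m) := rfl
  rw [hgr] at hy h0 h1
  have hpers : ∀ j ≤ P.bound m, Persists (S j).2 (P.table (m + 1)) := by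
    intro j hj
    refine Persists.trans ?_ hsub.persists
    rw [h1]
    refine Persists.trans (T' := (S (P.bound m)).2) ?_ (extends_insert (P := P) hy h0).persists
    obtain ⟨i, hi⟩ := Nat.exists_eq_add_of_le' hj
    simp only [hS, hi, Function.iterate_add_apply]
    exact ((freezes_greedyStep m _ _ i).extends (P := P) m).persists
  have hstep : ∀ j < P.bound m,
      (S (j + 1)).1 = (S j).1 ++ [!isLow (j + 1) (c (S j).1)] := by
    intro j hj
    have hp := hpers (j + 1) hj
    simp only [hS, Function.iterate_succ_apply'] at hp ⊢
    rw [greedyStep] at hp ⊢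
    have hw := hSlen j
    simp only [hS] at hw
    simp only [hw]
    rw [simulate_eq hP hp (hc _ (by rw [hw]; exact hj))]
  have hpre : ∀ j i, (S (j + i)).1.take j = (S j).1 := by
    intro j i
    induction i with
    | zero => rw [Nat.add_zero]; exact List.take_of_length_le (hSlen j).le
    | succ i ih =>
      have : (S (j + (i + 1))).1 = (S (j + i)).1 ++
          [!isLow ((S (j + i)).1.length + 1) (P.simulate m (Interp.encode p) (S (j + i)).1
            (S (j + i)).2).store.fst] := by
        simp only [hS, ← Nat.add_assoc, Function.iterate_succ_apply']; rfl
      rw [this, List.take_append_of_le_length (by rw [hSlen]; omega), ih]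
  refine ⟨(S (P.bound m)).1 ++ y, hy, ?_, ?_⟩
  · have hne : lookup (P.addProgram m T v) ((S (P.bound m)).1 ++ y) = ofRat (P.weight m) := by
      rw [h1, lookup_insert_self]
    rw [estimator, hy, hsub.persists _ (by rw [hne]; exact ofRat_ne_nil _), hne, toRat_ofRat]
  · have htake : ∀ j ≤ P.bound m, ((S (P.bound m)).1 ++ y).take j = (S j).1 := by
      intro j hj
      rw [List.take_append_of_le_length (by rw [hSlen]; exact hj)]
      obtain ⟨i, hi⟩ := Nat.exists_eq_add_of_le hj
      rw [hi]
      exact hpre j i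
    intro i hi
    rw [htake _ hi, htake _ hi.le, hstep i hi]

end Rates

/-! ### A small logic for programs with a fixed set of registers -/

/-- Names for the registers `0, …, 25`. -/
inductive Reg : Type
  | inp | tab | todo | una | drop | codes | fuel | cands | len | den | delta | prog | pre
  | shift | rest | found | cursor | clock | code | store | vy | vz | t1 | t2 | t3 | t4
  deriving DecidableEq

/-- The number of a register. -/
def Reg.idx (x : Reg) : ℕ := x.ctorIdx

theorem Reg.idx_lt (x : Reg) : x.idx < 26 := by
  cases x <;> decide

theorem Reg.idx_injective : Function.Injective Reg.idx := by
  intro x y h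
  rw [← Reg.ofNat_ctorIdx x, ← Reg.ofNat_ctorIdx y]
  exact congrArg Reg.ofNat h

/-- Expressions over named registers. -/
inductive CellExpr : Type
  | nil : CellExpr
  | reg (x : Reg) : CellExpr
  | cons (a b : CellExpr) : CellExpr
  | fst (a : CellExpr) : CellExpr
  | snd (a : CellExpr) : CellExpr
  | ite (a b c : CellExpr) : CellExpr

instance : Coe Reg CellExpr := ⟨.reg⟩

/-- The contents of the registers `0, …, 25`, in this order. The registers from `26` on hold
intermediate results of expressions and are not recorded. -/
structure Regs where
  inp : Cell
  tab : Cell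
  todo : Cell
  una : Cell
  drop : Cell
  codes : Cell
  fuel : Cell
  cands : Cell
  len : Cell
  den : Cell
  delta : Cell
  prog : Cell
  pre : Cell
  shift : Cell
  rest : Cell
  found : Cell
  cursor : Cell
  clock : Cell
  code : Cell
  store : Cell
  vy : Cell
  vz : Cell
  t1 : Cell
  t2 : Cell
  t3 : Cell
  t4 : Cell

namespace Regs

/-- The contents of a register. -/
def get (s : Regs) : Reg → Cell
  | .inp => s.inp | .tab => s.tab | .todo => s.todo | .una => s.una | .drop => s.drop
  | .codes => s.codes | .fuel => s.fuel | .cands => s.cands | .len => s.len | .den => s.den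
  | .delta => s.delta | .prog => s.prog | .pre => s.pre | .shift => s.shift | .rest => s.rest
  | .found => s.found | .cursor => s.cursor | .clock => s.clock | .code => s.code
  | .store => s.store | .vy => s.vy | .vz => s.vz | .t1 => s.t1 | .t2 => s.t2 | .t3 => s.t3
  | .t4 => s.t4

/-- Change the contents of a register. -/
def set (s : Regs) (x : Reg) (v : Cell) : Regs :=
  match x with
  | .inp => { s with inp := v } | .tab => { s with tab := v } | .todo => { s with todo := v }
  | .una => { s with una := v } | .drop => { s with drop := v }
  | .codes => { s with codes := v } | .fuel => { s with fuel := v }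
  | .cands => { s with cands := v } | .len => { s with len := v } | .den => { s with den := v }
  | .delta => { s with delta := v } | .prog => { s with prog := v }
  | .pre => { s with pre := v } | .shift => { s with shift := v }
  | .rest => { s with rest := v } | .found => { s with found := v }
  | .cursor => { s with cursor := v } | .clock => { s with clock := v }
  | .code => { s with code := v } | .store => { s with store := v } | .vy => { s with vy := v }
  | .vz => { s with vz := v } | .t1 => { s with t1 := v } | .t2 => { s with t2 := v }
  | .t3 => { s with t3 := v } | .t4 => { s with t4 := v }

theorem get_set (s : Regs) (x : Reg) (v : Cell) (i : Reg) :
    (s.set x v).get i = if i = x then v else s.get i := by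
  split_ifs with h
  · subst h
    cases i <;> rfl
  · cases x <;> cases i <;> first | rfl | exact absurd rfl h

/-- The registers of the machine hold what is recorded in `s`. -/
def Agrees (s : Regs) (ρ : ℕ → Cell) : Prop :=
  ∀ x : Reg, ρ x.idx = s.get x

end Regs

/-- The program `p` runs in exactly `t` steps and changes the registers from `ρ` to `ρ'`. -/
def Exec (o : List Bool → ℚ≥0) (p : Prog) (t : ℕ) (ρ ρ' : ℕ → Cell) : Prop :=
  ∀ K, (Prog.step o)^[t] (p :: K, ρ) = (K, ρ')

theorem Exec.seq {o : List Bool → ℚ≥0} {p q : Prog} {t t' : ℕ} {ρ₁ ρ₂ ρ₃ : ℕ → Cell}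
    (h : Exec o p t ρ₁ ρ₂) (h' : Exec o q t' ρ₂ ρ₃) :
    Exec o (.seq p q) (t' + (t + 1)) ρ₁ ρ₃ := by
  intro K
  rw [Function.iterate_add_apply, Function.iterate_succ_apply, Prog.step, h, h']

/-- The conditional: `a` if the tree is nonempty, and `b` otherwise. -/
def Cell.select : Cell → Cell → Cell → Cell
  | .cons _ _, a, _ => a
  | .nil, _, b => b

theorem Cell.select_eq (c a b : Cell) : c.select a b = if c.isCons = true then a else b := by
  cases c <;> rfl

namespace CellExpr

/-- The value of an expression. -/
def eval (s : Regs) : CellExpr → Cell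
  | nil => .nil
  | reg x => s.get x
  | cons a b => .cons (a.eval s) (b.eval s)
  | fst a => (a.eval s).fst
  | snd a => (a.eval s).snd
  | ite a b c => (a.eval s).select (b.eval s) (c.eval s)

/-- A program that evaluates an expression into the register `d`, with the registers above as
a stack. -/
def compile : CellExpr → ℕ → Prog
  | nil, d => .clear d
  | reg x, d => .copy d x.idx
  | cons a b, d => .seq (a.compile d) (.seq (b.compile (d + 1)) (.cons d d (d + 1)))
  | fst a, d => .seq (a.compile d) (.fst d d)
  | snd a, d => .seq (a.compile d) (.snd d d)
  | ite a b c, d => .seq (a.compile d) (.ite d (b.compile d) (c.compile d))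

/-- A bound for the time that the evaluation of an expression takes. -/
def cost : CellExpr → ℕ
  | nil => 1
  | reg _ => 1
  | cons a b => a.cost + b.cost + 3
  | fst a => a.cost + 2
  | snd a => a.cost + 2
  | ite a b c => a.cost + b.cost + c.cost + 2

theorem exec_compile (o : List Bool → ℚ≥0) (e : CellExpr) (s : Regs) {d : ℕ} (hd : 26 ≤ d)
    {ρ : ℕ → Cell} (h : s.Agrees ρ) :
    ∃ ρ', (∀ i < d, ρ' i = ρ i) ∧ ρ' d = e.eval s ∧ ∃ t ≤ e.cost, Exec o (e.compile d) t ρ ρ' := by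
  have agrees : ∀ {d : ℕ} {ρ ρ' : ℕ → Cell}, 26 ≤ d → s.Agrees ρ → (∀ i < d, ρ' i = ρ i) →
      s.Agrees ρ' := fun hd h h' x => (h' _ (x.idx_lt.trans_le hd)).trans (h x)
  have update : ∀ {ρ ρ' : ℕ → Cell} {d : ℕ} {v : Cell}, (∀ i < d, ρ' i = ρ i) →
      ∀ i < d, Function.update ρ' d v i = ρ i := fun h i hi => by
    rw [Function.update_of_ne hi.ne, h i hi]
  induction e generalizing d ρ with
  | nil => exact ⟨Function.update ρ d .nil, update fun _ _ => rfl, by simp [eval], 1, le_rfl,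
      fun K => rfl⟩
  | reg x => exact ⟨Function.update ρ d (ρ x.idx), update fun _ _ => rfl, by simp [eval, h x], 1,
      le_rfl, fun K => rfl⟩
  | cons a b iha ihb =>
    obtain ⟨ρ₁, h₁, v₁, t₁, ht₁, e₁⟩ := iha hd h
    obtain ⟨ρ₂, h₂, v₂, t₂, ht₂, e₂⟩ := ihb (d := d + 1) (by omega) (agrees hd h h₁)
    refine ⟨Function.update ρ₂ d (.cons (ρ₂ d) (ρ₂ (d + 1))), update fun i hi => ?_, ?_, _, ?_,
      e₁.seq (e₂.seq (t' := 1) fun K => rfl)⟩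
    · rw [h₂ i (by omega), h₁ i hi]
    · simp [eval, v₂, h₂ d (by omega), v₁]
    · simp only [cost]; omega
  | fst a iha =>
    obtain ⟨ρ₁, h₁, v₁, t₁, ht₁, e₁⟩ := iha hd h
    exact ⟨Function.update ρ₁ d (ρ₁ d).fst, update h₁, by simp [eval, v₁], _,
      by simp only [cost]; omega, e₁.seq (t' := 1) fun K => rfl⟩
  | snd a iha =>
    obtain ⟨ρ₁, h₁, v₁, t₁, ht₁, e₁⟩ := iha hd h
    exact ⟨Function.update ρ₁ d (ρ₁ d).snd, update h₁, by simp [eval, v₁], _,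
      by simp only [cost]; omega, e₁.seq (t' := 1) fun K => rfl⟩
  | ite a b c iha ihb ihc =>
    obtain ⟨ρ₁, h₁, v₁, t₁, ht₁, e₁⟩ := iha hd h
    by_cases hc : (a.eval s).isCons = true
    · obtain ⟨ρ₂, h₂, v₂, t₂, ht₂, e₂⟩ := ihb hd (agrees hd h h₁)
      refine ⟨ρ₂, fun i hi => by rw [h₂ i hi, h₁ i hi], by simp [eval, Cell.select_eq, hc, v₂],
        t₂ + 1 + (t₁ + 1),
        by simp only [cost]; omega, e₁.seq fun K => ?_⟩
      rw [Function.iterate_succ_apply, Prog.step, v₁, if_pos hc, e₂]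
    · obtain ⟨ρ₂, h₂, v₂, t₂, ht₂, e₂⟩ := ihc hd (agrees hd h h₁)
      refine ⟨ρ₂, fun i hi => by rw [h₂ i hi, h₁ i hi], by simp [eval, Cell.select_eq, hc, v₂],
        t₂ + 1 + (t₁ + 1),
        by simp only [cost]; omega, e₁.seq fun K => ?_⟩
      rw [Function.iterate_succ_apply, Prog.step, v₁, if_neg hc, e₂]

end CellExpr

/-- The program `p` runs in at most `t` steps and changes the registers from `s` to `s'`. -/
def Runs (o : List Bool → ℚ≥0) (p : Prog) (t : ℕ) (s s' : Regs) : Prop :=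
  ∀ ρ, s.Agrees ρ → ∃ ρ', s'.Agrees ρ' ∧ ∃ t' ≤ t, Exec o p t' ρ ρ'

variable {o : List Bool → ℚ≥0}

theorem Runs.mono {p : Prog} {t t' : ℕ} {s s' : Regs} (h : Runs o p t s s') (ht : t ≤ t') :
    Runs o p t' s s' := by
  intro ρ hρ
  obtain ⟨ρ', h1, t₀, h2, h3⟩ := h ρ hρ
  exact ⟨ρ', h1, t₀, h2.trans ht, h3⟩

theorem Runs.seq {p q : Prog} {t t' : ℕ} {s₁ s₂ s₃ : Regs} (h : Runs o p t s₁ s₂)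
    (h' : Runs o q t' s₂ s₃) : Runs o (.seq p q) (t + t' + 1) s₁ s₃ := by
  intro ρ hρ
  obtain ⟨ρ₁, h1, t₁, h2, h3⟩ := h ρ hρ
  obtain ⟨ρ₂, h4, t₂, h5, h6⟩ := h' ρ₁ h1
  exact ⟨ρ₂, h4, _, by omega, h3.seq h6⟩

theorem Runs.loop_nil {x : Reg} {p : Prog} {s : Regs} (h : ¬(s.get x).isCons = true) :
    Runs o (.loop x.idx p) 1 s s := by
  intro ρ hρ
  refine ⟨ρ, hρ, 1, le_rfl, fun K => ?_⟩
  rw [Function.iterate_one, Prog.step, hρ x, if_neg h]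

theorem Runs.loop_cons {x : Reg} {p : Prog} {t t' : ℕ} {s₁ s₂ s₃ : Regs}
    (h : (s₁.get x).isCons = true) (h₁ : Runs o p t s₁ s₂) (h₂ : Runs o (.loop x.idx p) t' s₂ s₃) :
    Runs o (.loop x.idx p) (t + t' + 1) s₁ s₃ := by
  intro ρ hρ
  obtain ⟨ρ₁, h1, t₁, h2, h3⟩ := h₁ ρ hρ
  obtain ⟨ρ₂, h4, t₂, h5, h6⟩ := h₂ ρ₁ h1
  refine ⟨ρ₂, h4, t₂ + t₁ + 1, by omega, fun K => ?_⟩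
  rw [Function.iterate_succ_apply, Prog.step, hρ x, if_pos h, Function.iterate_add_apply, h3, h6]

/-- A loop that goes through the states `st 0, …, st N`. -/
theorem Runs.loop {x : Reg} {p : Prog} {c N : ℕ} (st : ℕ → Regs)
    (h : ∀ j < N, ((st j).get x).isCons = true ∧ Runs o p c (st j) (st (j + 1)))
    (hN : ¬((st N).get x).isCons = true) :
    Runs o (.loop x.idx p) (N * (c + 1) + 1) (st 0) (st N) := by
  suffices ∀ i j, i + j = N → Runs o (.loop x.idx p) (i * (c + 1) + 1) (st j) (st N) from
    this N 0 rfl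
  intro i
  induction i with
  | zero => intro j hj; rw [show j = N by omega, Nat.zero_mul]; exact .loop_nil hN
  | succ i ih =>
    intro j hj
    obtain ⟨h1, h2⟩ := h j (by omega)
    refine (Runs.loop_cons h1 h2 (ih (j + 1) (by omega))).mono ?_
    rw [Nat.add_mul]; omega

theorem isCons_iterate_snd {c : Cell} {j : ℕ} :
    (Cell.snd^[j] c).isCons = true ↔ j < c.toBits.length := by
  induction j generalizing c with
  | zero => cases c <;> simp
  | succ j ih => cases c <;> simp [ih]

/-- A loop that goes through the list in register `x`. -/
theorem Runs.loop_list {x : Reg} {p : Prog} {c : ℕ} {s : Regs} (F : Regs → Regs)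
    (hx : ∀ s, (F s).get x = (s.get x).snd)
    (h : ∀ j < (s.get x).toBits.length, Runs o p c (F^[j] s) (F^[j + 1] s)) :
    Runs o (.loop x.idx p) ((s.get x).toBits.length * (c + 1) + 1) s
      (F^[(s.get x).toBits.length] s) := by
  have hj : ∀ j, (F^[j] s).get x = Cell.snd^[j] (s.get x) := by
    intro j
    induction j with
    | zero => rfl
    | succ j ih => rw [Function.iterate_succ_apply', hx, ih, Function.iterate_succ_apply']
  exact Runs.loop (fun j => F^[j] s)
    (fun j hlt => ⟨by rw [hj, isCons_iterate_snd]; exact hlt, h j hlt⟩)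
    (by rw [hj, isCons_iterate_snd]; exact lt_irrefl _)

/-- Consecutive assignments. -/
def block : List (Reg × CellExpr) → Prog
  | [] => .clear 26
  | (x, e) :: l => .seq (.seq (e.compile 26) (.copy x.idx 26)) (block l)

/-- The effect of consecutive assignments. -/
def blockExec : List (Reg × CellExpr) → Regs → Regs
  | [], s => s
  | (x, e) :: l, s => blockExec l (s.set x (e.eval s))

/-- A bound for the time that consecutive assignments take. -/
def blockCost : List (Reg × CellExpr) → ℕ
  | [] => 1
  | (_, e) :: l => e.cost + blockCost l + 3

theorem runs_block (l : List (Reg × CellExpr)) (s : Regs) :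
    Runs o (block l) (blockCost l) s (blockExec l s) := by
  induction l generalizing s with
  | nil =>
    intro ρ hρ
    refine ⟨Function.update ρ 26 .nil, fun i => ?_, 1, le_rfl, fun K => rfl⟩
    rw [Function.update_of_ne i.idx_lt.ne]
    exact hρ i
  | cons a l ih =>
    obtain ⟨x, e⟩ := a
    refine (Runs.seq (t := e.cost + 2) ?_ (ih _)).mono (by simp only [blockCost]; omega)
    intro ρ hρ
    obtain ⟨ρ', h, hv, t, ht, he⟩ := e.exec_compile o s le_rfl hρ
    refine ⟨Function.update ρ' x.idx (ρ' 26), fun i => ?_, _, ?_, he.seq (t' := 1) fun K => rfl⟩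
    · rw [Regs.get_set, hv]
      split_ifs with hi
      · rw [hi, Function.update_self]
      · rw [Function.update_of_ne (fun h => hi (Reg.idx_injective h)), h _ i.idx_lt, hρ i]
    · omega

theorem Runs.of_block {l : List (Reg × CellExpr)} {s s' : Regs} {t : ℕ}
    (h : blockExec l s = s') (ht : blockCost l ≤ t) : Runs o (block l) t s s' :=
  h ▸ (runs_block l s).mono ht

/-! ### Subroutines -/

namespace Routine

open Cell Reg

/-- Fold a function over the elements of a list. -/
def foldCell (f : Cell → Cell → Cell) : Cell → Cell → Cell
  | a, nil => a
  | a, .cons c l => foldCell f (f a c) l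

/-- A loop through the list in `t2` that accumulates a result in `t1`. -/
def fold (e : CellExpr) : Prog :=
  .loop t2.idx (block [(t1, e), (t2, .snd t2)])

theorem runs_fold {e : CellExpr} {f : Cell → Cell → Cell}
    (he : ∀ s, e.eval s = f s.t1 s.t2.fst) (s : Regs) :
    Runs o (fold e) (s.t2.toBits.length * (e.cost + 11) + 1) s
      ((s.set t1 (foldCell f s.t1 s.t2)).set t2 nil) := by
  suffices ∀ (c : Cell) (s : Regs), s.t2 = c →
      Runs o (fold e) (c.toBits.length * (e.cost + 11) + 1) s
        ((s.set t1 (foldCell f s.t1 c)).set t2 nil) from this s.t2 s rfl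
  intro c
  induction c with
  | nil =>
    intro s hs
    have : s = ((s.set t1 (foldCell f s.t1 nil)).set t2 nil) := by
      cases s; cases hs; rfl
    rw [← this]
    exact (Runs.loop_nil (by rw [show s.get t2 = nil from hs]; simp)).mono (by omega)
  | cons a c _ ih =>
    intro s hs
    refine (Runs.loop_cons (t := e.cost + 10) ?_
      (.of_block (s' := ((s.set t1 (f s.t1 a)).set t2 c)) ?_ ?_)
      (ih ((s.set t1 (f s.t1 a)).set t2 c) rfl)).mono ?_
    · rw [show s.get t2 = _ from hs]; rfl
    · have : blockExec [(t1, e), (t2, .snd t2)] s =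
        ((s.set t1 (e.eval s)).set t2 s.t2.snd) := rfl
      rw [this, he, hs]; rfl
    · simp only [blockCost, CellExpr.cost]; omega
    · simp only [toBits_cons, List.length_cons, Nat.add_mul]; omega

/-- Replace the trie in `t1` by its entry at the string in `t2`. -/
def lookupRoutine : Prog :=
  .seq (fold (.ite (.fst t2) (.snd (.snd t1)) (.fst (.snd t1)))) (block [(t1, .fst t1)])

theorem runs_lookup (s : Regs) :
    Runs o lookupRoutine (26 * s.t2.toBits.length + 10) s
      ((s.set t1 (lookup s.t1 s.t2.toBits)).set t2 nil) := by
  refine ((runs_fold (f := fun T a => if a.isCons = true then T.snd.snd else T.snd.fst)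
    (fun s => by simp only [CellExpr.eval, Regs.get, select_eq]) s).seq
      (.of_block (t := 7) ?_ (by decide))).mono
      (by simp only [CellExpr.cost]; omega)
  have : ∀ c T : Cell, (foldCell (fun T a => if a.isCons = true then T.snd.snd else T.snd.fst)
      T c).fst = lookup T c.toBits := by
    intro c
    induction c with
    | nil => intro T; rfl
    | cons a c _ ih => intro T; exact ih _
  rw [← this]
  rfl

/-- Reverse the list in `t2` and put it in front of the list in `t1`. -/
def revAppRoutine : Prog := fold (.cons (.fst t2) t1)

theorem runs_revApp (s : Regs) :
    Runs o revAppRoutine (20 * s.t2.toBits.length + 1) s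
      ((s.set t1 (revApp s.t2 s.t1)).set t2 nil) := by
  have : ∀ c d : Cell, foldCell (fun d a => .cons a d) d c = revApp c d := by
    intro c
    induction c with
    | nil => intro d; rfl
    | cons a c _ ih => intro d; exact ih _
  rw [← this]
  exact (runs_fold (fun s => rfl) s).mono (by simp only [CellExpr.cost]; omega)

/-- Add the tree in `t1` to which the postfix notation in `t2` evaluates. -/
def decodeRoutine : Prog :=
  fold (.ite (.fst t2) (.cons (.cons (.fst (.snd t1)) (.fst t1)) (.snd (.snd t1))) (.cons .nil t1))

theorem runs_decode (s : Regs) :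
    Runs o decodeRoutine (42 * s.t2.toBits.length + 1) s
      ((s.set t1 (s.t2.toBits.foldl pushBit s.t1)).set t2 nil) := by
  have : ∀ c d : Cell, foldCell (fun d a => pushBit d a.isCons) d c = c.toBits.foldl pushBit d := by
    intro c
    induction c with
    | nil => intro d; rfl
    | cons a c _ ih => intro d; exact ih _
  rw [← this]
  exact (runs_fold (fun s => by simp only [CellExpr.eval, Regs.get, select_eq, pushBit]) s).mono
    (by simp only [CellExpr.cost]; omega)

/-- A list of strings as a tree. -/
def ofStrings (l : List (List Bool)) : Cell := ofList (l.map ofBits)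

@[simp] theorem length_toBits_ofStrings (l : List (List Bool)) :
    (ofStrings l).toBits.length = l.length := by
  simp [ofStrings]

/-- Replace the list of strings in `t1` by the list of the strings with a bit in front. -/
def doubleRoutine : Prog :=
  .seq (block [(t2, t1), (t1, .nil)])
    (fold (.cons (.cons .nil (.fst t2)) (.cons (.cons (.cons .nil .nil) (.fst t2)) t1)))

theorem runs_double (s : Regs) (l : List (List Bool)) (h : s.t1 = ofStrings l) :
    Runs o doubleRoutine (41 * l.length + 11) s ((s.set t1 (ofStrings (double l))).set t2 nil) := by
  have : ∀ l acc : List (List Bool), foldCell (fun d a => .cons (.cons nil a) (.cons (.cons one a) d))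
      (ofStrings acc) (ofStrings l) =
      ofStrings (l.foldl (fun acc v => (false :: v) :: (true :: v) :: acc) acc) := by
    intro l
    induction l with
    | nil => intro d; rfl
    | cons v l ih => intro acc; exact ih ((false :: v) :: (true :: v) :: acc)
  have h1 := this l []
  have h2 : Runs o (block [(t2, t1), (t1, .nil)]) 9 s ((s.set t1 nil).set t2 (ofStrings l)) :=
    .of_block (by rw [← h]; rfl) (by decide)
  have h3 := runs_fold (o := o) (e := .cons (.cons .nil (.fst t2))
    (.cons (.cons (.cons .nil .nil) (.fst t2)) t1))
    (f := fun d a => .cons (.cons nil a) (.cons (.cons one a) d)) (fun s => rfl)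
    ((s.set t1 nil).set t2 (ofStrings l))
  have h4 : (((s.set t1 nil).set t2 (ofStrings l)).set t1 (foldCell (fun d a => .cons (.cons nil a)
      (.cons (.cons one a) d)) nil (ofStrings l))).set t2 nil =
      (s.set t1 (ofStrings (double l))).set t2 nil := by
    rw [← show _ = ofStrings (double l) from h1]; rfl
  rw [← h4]
  refine (h2.seq h3).mono ?_
  have : ((s.set t1 nil).set t2 (ofStrings l)).t2.toBits.length = l.length :=
    length_toBits_ofStrings l
  rw [this]
  simp only [CellExpr.cost]; omega

/-- Run a program `n` times. -/
def iter (p : Prog) : ℕ → Prog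
  | 0 => block []
  | n + 1 => .seq (iter p n) p

theorem runs_iter_double (s : Regs) (l : List (List Bool)) (h : s.t1 = ofStrings l)
    (h2 : s.t2 = nil) (n : ℕ) :
    Runs o (iter doubleRoutine n) (53 * n * (2 ^ n * l.length + 1) + 1) s
      (s.set t1 (ofStrings (double^[n] l))) := by
  induction n with
  | zero => exact .of_block (by rw [Function.iterate_zero_apply, ← h]; rfl) (by simp [blockCost])
  | succ n ih =>
    have hlen : (double^[n] l).length = 2 ^ n * l.length := by
      clear ih
      induction n with
      | zero => simp
      | succ n ih => rw [Function.iterate_succ_apply', length_double, ih, pow_succ]; ring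
    have h3 := runs_double (o := o) (s.set t1 (ofStrings (double^[n] l))) _ rfl
    rw [Function.iterate_succ_apply']
    have h4 := (ih.seq h3).mono (t' := 53 * (n + 1) * (2 ^ (n + 1) * l.length + 1) + 1) (by
      rw [hlen, pow_succ]
      nlinarith [Nat.zero_le (n * (2 ^ n * l.length)), Nat.zero_le (2 ^ n * l.length)])
    rw [← h2] at h4
    exact h4

/-- The first loop of `insertRoutine`: go down in the trie and keep the way on a stack. -/
def descend : List (Reg × CellExpr) :=
  [(t4, .cons (.cons (.fst t2) t1) t4),
   (t1, .ite (.fst t2) (.snd (.snd t1)) (.fst (.snd t1))),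
   (t2, .snd t2)]

/-- The second loop of `insertRoutine`: go back and rebuild the trie. -/
def climb : List (Reg × CellExpr) :=
  [(t1, .cons (.fst (.snd (.fst t4))) (.ite (.fst (.fst t4))
      (.cons (.fst (.snd (.snd (.fst t4)))) t1) (.cons t1 (.snd (.snd (.snd (.fst t4))))))),
   (t4, .snd t4)]

/-- Replace the entry of the trie in `t1` at the string in `t2` by `t3`. The stack `t4` has to be
empty. -/
def insertRoutine : Prog :=
  .seq (.loop t2.idx (block descend))
    (.seq (block [(t1, .cons t3 (.snd t1))]) (.loop t4.idx (block climb)))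

/-- Change the three registers with which `insertRoutine` works. -/
def setTrie (s : Regs) (T c S : Cell) : Regs :=
  ((s.set t1 T).set t2 c).set t4 S

theorem runs_insert (s : Regs) (h4 : s.t4 = nil) :
    Runs o insertRoutine (100 * s.t2.toBits.length + 20) s
      ((s.set t1 (insert s.t1 s.t2.toBits s.t3)).set t2 nil) := by
  have key : ∀ c T₀ S₀ : Cell, ∃ T S : Cell,
      Runs o (.loop t2.idx (block descend)) (45 * c.toBits.length + 1)
        (setTrie s T₀ c S₀) (setTrie s T nil S) ∧
      ∀ t r, Runs o (.loop t4.idx (block climb)) t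
          (setTrie s (insert T₀ c.toBits s.t3) nil S₀) r →
        Runs o (.loop t4.idx (block climb)) (t + 55 * c.toBits.length)
          (setTrie s (.cons s.t3 T.snd) nil S) r := by
    intro c
    induction c with
    | nil => exact fun T₀ S₀ => ⟨T₀, S₀, .loop_nil (Bool.false_ne_true), fun t r h => h⟩
    | cons a c _ ih =>
      intro T₀ S₀
      obtain ⟨T, S, hdown, hup⟩ := ih (if a.isCons = true then T₀.snd.snd else T₀.snd.fst)
        (.cons (.cons a T₀) S₀)
      have hd : blockExec descend (setTrie s T₀ (.cons a c) S₀) = setTrie s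
        (if a.isCons = true then T₀.snd.snd else T₀.snd.fst) c (.cons (.cons a T₀) S₀) := by
        simp only [blockExec, descend, setTrie, Regs.set, CellExpr.eval, Regs.get, select_eq, fst_cons,
          snd_cons]
      have hc : ∀ U, blockExec climb (setTrie s U nil (.cons (.cons a T₀) S₀)) = setTrie s
        (.cons T₀.fst (if a.isCons = true then .cons T₀.snd.fst U else .cons U T₀.snd.snd)) nil S₀ := by
        intro U
        simp only [blockExec, climb, setTrie, Regs.set, CellExpr.eval, Regs.get, select_eq, fst_cons,
          snd_cons]
      refine ⟨T, S, (Runs.loop_cons (t := 44) rfl (.of_block hd (by decide)) hdown).mono ?_,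
        fun t r h => ?_⟩
      · simp only [toBits_cons, List.length_cons]; omega
      · refine (hup (t + 55) r ((Runs.loop_cons (t := 54) rfl (.of_block (hc _) (by decide)) h).mono
          (by omega))).mono (by simp only [toBits_cons, List.length_cons]; omega)
  obtain ⟨T, S, hdown, hup⟩ := key s.t2 s.t1 nil
  have hs : setTrie s s.t1 s.t2 nil = s := by rw [← h4]; rfl
  have hs' : setTrie s (insert s.t1 s.t2.toBits s.t3) nil nil =
    (s.set t1 (insert s.t1 s.t2.toBits s.t3)).set t2 nil := by rw [← h4]; rfl
  have hm : blockExec [(t1, .cons t3 (.snd t1))] (setTrie s T nil S) =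
    setTrie s (.cons s.t3 T.snd) nil S := rfl
  have hnil := hup 1 _ (.loop_nil (Bool.false_ne_true))
  rw [hs] at hdown
  rw [hs'] at hnil
  exact (hdown.seq ((Runs.of_block (t := 14) hm (by decide)).seq hnil)).mono (by omega)

/-! ### Comparing two numbers -/

/-- The loop of `compareRoutine`. -/
def compareBits : List (Reg × CellExpr) :=
  [(t3, .ite (.fst t1) (.ite (.fst t2) t3 .nil) (.ite (.fst t2) (.cons .nil .nil) t3)),
   (vy, .ite (.fst t2) (.cons .nil .nil) vy),
   (t1, .snd t1), (t2, .snd t2)]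

/-- Compare the binary numbers in `t1` and `t2`, starting with the least significant digits. In the
end, `t3` tells whether the first number is at most the second, and `vy` tells whether the second
number is positive. -/
def compareRoutine : Prog :=
  .seq (block [(t3, .cons .nil .nil), (vy, .nil)])
    (.seq (.loop t1.idx (block compareBits)) (.loop t2.idx (block compareBits)))

/-- What the comparison will tell, if `a` and `b` remain to be compared, and `c` and `d` are the
results for the digits that have been read. -/
def comparison (a b c d : Cell) : Prop × Prop :=
  (a.toNat < b.toNat ∨ a.toNat = b.toNat ∧ c.isCons = true, 0 < b.toNat ∨ d.isCons = true)

theorem toNat_eq (c : Cell) : c.toNat = 2 * c.snd.toNat + c.fst.isCons.toNat := by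
  cases c <;> simp [toNat_eq_bitsVal]

/-- Reading a pair of digits does not change the final result of the comparison. -/
theorem comparison_step (a b c d : Cell) :
    comparison a.snd b.snd
      (if a.fst.isCons = true then (if b.fst.isCons = true then c else nil)
        else if b.fst.isCons = true then .cons nil nil else c)
      (if b.fst.isCons = true then .cons nil nil else d) = comparison a b c d := by
  simp only [comparison, toNat_eq a, toNat_eq b]
  cases h1 : a.fst.isCons <;> cases h2 : b.fst.isCons <;> simp <;> omega

/-- Change the four registers of the comparison. -/
def setCompare (s : Regs) (a b c d : Cell) : Regs :=
  (((s.set t3 c).set vy d).set t1 a).set t2 b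

theorem compare_iterate (s : Regs) (j : ℕ) : ∃ c d : Cell,
    (blockExec compareBits)^[j] s = setCompare s (snd^[j] s.t1) (snd^[j] s.t2) c d ∧
    comparison (snd^[j] s.t1) (snd^[j] s.t2) c d = comparison s.t1 s.t2 s.t3 s.vy := by
  induction j with
  | zero => exact ⟨s.t3, s.vy, by simp only [setCompare, Regs.set, Function.iterate_zero_apply], rfl⟩
  | succ j ih =>
    obtain ⟨c, d, h1, h2⟩ := ih
    rw [← comparison_step] at h2
    simp only [Function.iterate_succ_apply', h1]
    generalize snd^[j] s.t1 = a, snd^[j] s.t2 = b at h2 ⊢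
    exact ⟨if a.fst.isCons = true then (if b.fst.isCons = true then c else nil)
        else if b.fst.isCons = true then .cons nil nil else c,
      if b.fst.isCons = true then .cons nil nil else d, by
        simp only [blockExec, compareBits, setCompare, Regs.set, CellExpr.eval, Regs.get,
          select_eq], h2⟩

theorem iterate_snd_eq_nil {c : Cell} {j : ℕ} (h : c.toBits.length ≤ j) : snd^[j] c = nil := by
  by_contra hne
  exact (isCons_iterate_snd.1 (isCons_iff_ne_nil.2 hne)).not_ge h

theorem length_toBits_iterate_snd (c : Cell) (j : ℕ) :
    (snd^[j] c).toBits.length ≤ c.toBits.length := by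
  induction j with
  | zero => rfl
  | succ j ih =>
    rw [Function.iterate_succ_apply']
    refine le_trans ?_ ih
    cases snd^[j] c <;> simp

theorem runs_compareBits {x : Reg} (s : Regs) (n : ℕ) (hn : (s.get x).toBits.length = n)
    (hx : ∀ s, (blockExec compareBits s).get x = (s.get x).snd) : ∃ c d : Cell,
    Runs o (.loop x.idx (block compareBits)) (60 * n + 1) s
      (setCompare s (snd^[n] s.t1) (snd^[n] s.t2) c d) ∧
    comparison (snd^[n] s.t1) (snd^[n] s.t2) c d = comparison s.t1 s.t2 s.t3 s.vy := by
  subst hn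
  obtain ⟨c, d, h1, h2⟩ := compare_iterate s (s.get x).toBits.length
  refine ⟨c, d, ?_, h2⟩
  rw [← h1]
  refine (Runs.loop_list (c := 59) (blockExec compareBits) hx fun j _ => ?_).mono (by omega)
  rw [Function.iterate_succ_apply']
  exact (runs_block _ _).mono (by decide)

theorem setCompare_setCompare (s : Regs) (a b c d a' b' c' d' : Cell) :
    setCompare (setCompare s a b c d) a' b' c' d' = setCompare s a' b' c' d' := by
  simp only [setCompare, Regs.set]

theorem runs_compare (s : Regs) : ∃ c d : Cell,
    Runs o compareRoutine (60 * (s.t1.toBits.length + s.t2.toBits.length) + 20) s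
      (setCompare s nil nil c d) ∧
    (c.isCons = true ↔ s.t1.toNat ≤ s.t2.toNat) ∧ (d.isCons = true ↔ 0 < s.t2.toNat) := by
  have hlen := length_toBits_iterate_snd s.t2 s.t1.toBits.length
  obtain ⟨c, d, hr1, h1⟩ := runs_compareBits (o := o) (x := t1) (setCompare s s.t1 s.t2 one nil)
    s.t1.toBits.length (by simp only [setCompare, Regs.set, Regs.get]) fun s => by
      simp only [blockExec, compareBits, Regs.set, CellExpr.eval, Regs.get]
  rw [setCompare_setCompare] at hr1
  simp only [setCompare, Regs.set] at h1
  have e1 : snd^[s.t1.toBits.length] s.t1 = nil := iterate_snd_eq_nil le_rfl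
  obtain ⟨c', d', hr2, h2⟩ := runs_compareBits (o := o) (x := t2)
    (setCompare s (snd^[s.t1.toBits.length] s.t1) (snd^[s.t1.toBits.length] s.t2) c d) _ rfl
    fun s => by simp only [blockExec, compareBits, Regs.set, CellExpr.eval, Regs.get]
  rw [setCompare_setCompare] at hr2
  simp only [setCompare, Regs.set, Regs.get] at h1 h2 hr2 hr1
  have e2 : ∀ i, snd^[i] nil = nil := fun i => iterate_snd_eq_nil (by simp)
  rw [e1] at h1 h2 hr1 hr2
  rw [iterate_snd_eq_nil le_rfl, e2] at h2 hr2
  have hb : blockExec [(t3, .cons .nil .nil), (vy, .nil)] s = setCompare s s.t1 s.t2 one nil := by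
    simp only [blockExec, setCompare, Regs.set, CellExpr.eval]; rfl
  simp only [setCompare, Regs.set] at hb ⊢
  refine ⟨c', d', ((Runs.of_block (t := 13) hb (by decide)).seq (hr1.seq hr2)).mono (by omega), ?_⟩
  have h5 := h2.trans h1
  have z : nil.toNat = 0 := rfl
  simp only [comparison, z, Prod.mk.injEq, lt_irrefl, false_or, true_and, isCons_one, isCons_nil,
    Bool.false_eq_true, or_false, and_true, eq_iff_iff] at h5
  exact ⟨h5.1.trans (by omega), h5.2⟩

end Routine

namespace Routine

open Cell Reg

/-! ### The interpreter as a program -/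

/-- The expression for the tail after `n` elements. -/
def drops (e : CellExpr) : ℕ → CellExpr
  | 0 => e
  | n + 1 => .snd (drops e n)

theorem eval_drops (s : Regs) (e : CellExpr) (n : ℕ) :
    (drops e n).eval s = snd^[n] (e.eval s) := by
  induction n with
  | zero => rfl
  | succ n ih => rw [Function.iterate_succ_apply', ← ih]; rfl

theorem cost_drops (e : CellExpr) (n : ℕ) : (drops e n).cost = e.cost + 2 * n := by
  induction n with
  | zero => rfl
  | succ n ih => simp only [drops, CellExpr.cost, ih]; omega

/-- The expression for the component `n` of the current instruction. -/
def part (n : ℕ) : CellExpr := .fst (drops (.fst code) n)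

/-- The expression for `Interp.value`. The oracle answer is expected in `t3`. -/
def valueExpr : CellExpr :=
  .ite (part 0) (.ite (.snd (part 0)) (.ite (drops (part 0) 2) (.ite (drops (part 0) 3)
    (.ite (drops (part 0) 4) t3 (.snd vy)) (.fst vy)) (.cons vy vz)) .nil) vy

/-- The expression for `Interp.next`. -/
def nextExpr : CellExpr :=
  .ite (part 1)
    (.ite (.snd (part 1))
      (.ite (drops (part 1) 2)
        (.ite vy (.cons (part 5) (.cons (.fst code) (.snd code))) (.snd code))
        (.cons (.ite vy (part 5) (drops (.fst code) 6)) (.snd code)))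
      (.cons (part 5) (.cons (drops (.fst code) 6) (.snd code))))
    (.snd code)

/-- One step of the interpreter. -/
def interpretRoutine : Prog :=
  .seq (.seq (block [(t1, store), (t2, part 3)]) lookupRoutine)
  (.seq (.seq (block [(vy, t1), (t1, store), (t2, part 4)]) lookupRoutine)
  (.seq (.seq (block [(vz, t1), (t1, tab), (t2, vy)]) lookupRoutine)
  (.seq (.seq (block [(t3, .ite t1 t1 (.cons .nil (.cons (.cons .nil .nil) .nil))), (t1, tab),
    (t2, vy)]) insertRoutine)
  (.seq (.seq (block [(tab, t1), (t3, valueExpr), (t1, store), (t2, part 2)]) insertRoutine)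
  (block [(store, t1), (code, nextExpr), (clock, .snd clock), (t1, .nil), (t3, .nil), (vy, .nil),
    (vz, .nil)])))))

/-- Change the registers with which the interpreter works. -/
def work (s : Regs) (K R T f a b c d e : Cell) : Regs :=
  ((((((((s.set code K).set store R).set tab T).set clock f).set t1 a).set t2 b).set t3 c).set
    vy d).set vz e

theorem runs_block_lookup {l : List (Reg × CellExpr)} {s s₀ : Regs} {K R T f a b c d e : Cell}
    (h : blockExec l s₀ = work s K R T f a b c d e) {n m : ℕ} (hn : b.toBits.length ≤ n)
    (hm : blockCost l ≤ m) :
    Runs o (.seq (block l) lookupRoutine) (26 * n + m + 11) s₀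
      (work s K R T f (lookup a b.toBits) nil c d e) := by
  have h1 := runs_lookup (o := o) (work s K R T f a b c d e)
  simp only [work, Regs.set] at h1
  simp only [work, Regs.set] at h ⊢
  exact ((Runs.of_block h hm).seq h1).mono (by omega)

theorem runs_block_insert {l : List (Reg × CellExpr)} {s s₀ : Regs} {K R T f a b c d e : Cell}
    (h : blockExec l s₀ = work s K R T f a b c d e) (h4 : s.t4 = nil) {n m : ℕ}
    (hn : b.toBits.length ≤ n) (hm : blockCost l ≤ m) :
    Runs o (.seq (block l) insertRoutine) (100 * n + m + 21) s₀
      (work s K R T f (insert a b.toBits c) nil c d e) := by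
  have h1 := runs_insert (o := o) (work s K R T f a b c d e) (by simpa only [work, Regs.set] using h4)
  simp only [work, Regs.set] at h1
  simp only [work, Regs.set] at h ⊢
  exact ((Runs.of_block h hm).seq h1).mono (by omega)

/-- Registers that hold the interpreter in state `S`, with `f` on the clock. -/
def setInterp (s : Regs) (S : Interp) (f : Cell) : Regs :=
  work s S.code S.store S.table f nil nil nil nil nil

theorem runs_interpret (s : Regs) (S : Interp) (f : Cell) (h4 : s.t4 = nil) {h H : ℕ}
    (hS : S.Bounded h H) :
    Runs o interpretRoutine (280 * h + 700) (setInterp s S f) (setInterp s S.step f.snd) := by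
  have hlen : ∀ n, (snd^[n] S.code.fst).fst.toBits.length ≤ h := by
    intro n
    refine (length_toBits_le_height _).trans ((height_fst_le _).trans ?_)
    refine le_trans ?_ ((height_fst_le S.code).trans hS.code)
    induction n with
    | zero => rfl
    | succ n ih => rw [Function.iterate_succ_apply']; exact (height_snd_le _).trans ih
  set y := lookup S.store S.code.fst.snd.snd.snd.fst.toBits with hy
  set z := lookup S.store S.code.fst.snd.snd.snd.snd.fst.toBits with hz
  have hyl : y.toBits.length ≤ h := (length_toBits_le_height _).trans (hS.store _)
  have H1 : Runs o _ (26 * h + 20 + 11) (setInterp s S f) (work s S.code S.store S.table f y nil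
      nil nil nil) :=
    runs_block_lookup (l := [(t1, store), (t2, part 3)]) (s := s) (by
      simp only [blockExec, setInterp, work, Regs.set, CellExpr.eval, Regs.get, part, drops])
      (hlen 3) (by decide)
  have H2 : Runs o _ (26 * h + 30 + 11) _ (work s S.code S.store S.table f z nil nil y nil) :=
    runs_block_lookup (l := [(vy, t1), (t1, store), (t2, part 4)]) (s := s)
      (s₀ := work s S.code S.store S.table f y nil nil nil nil) (by
      simp only [blockExec, work, Regs.set, CellExpr.eval, Regs.get, part, drops])
      (hlen 4) (by decide)
  have H3 : Runs o _ (26 * h + 20 + 11) _ (work s S.code S.store S.table f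
      (lookup S.table y.toBits) nil nil y z) :=
    runs_block_lookup (l := [(vz, t1), (t1, tab), (t2, vy)]) (s := s)
      (s₀ := work s S.code S.store S.table f z nil nil y nil) (by
      simp only [blockExec, work, Regs.set, CellExpr.eval, Regs.get])
      hyl (by decide)
  have H4 : Runs o _ (100 * h + 40 + 21) _ (work s S.code S.store S.table f
      S.step.table nil (Interp.answer S.table y.toBits) y z) :=
    runs_block_insert (l := [(t3, .ite t1 t1 (.cons .nil (.cons (.cons .nil .nil) .nil))), (t1, tab),
      (t2, vy)]) (s := s) (s₀ := work s S.code S.store S.table f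
      (lookup S.table y.toBits) nil nil y z) (a := S.table) (b := y) (by
      simp only [blockExec, work, Regs.set, CellExpr.eval, Regs.get, select_eq, Interp.answer, one, hy])
      h4 hyl (by decide)
  have H5 : Runs o _ (100 * h + 190 + 21) _ (work s S.code S.store S.step.table f
      S.step.store nil (Interp.value S.code.fst.fst y z (Interp.answer S.table y.toBits)) y z) :=
    runs_block_insert (l := [(tab, t1), (t3, valueExpr), (t1, store), (t2, part 2)]) (s := s)
      (s₀ := work s S.code S.store S.table f
        S.step.table nil (Interp.answer S.table y.toBits) y z)
      (b := S.code.fst.snd.snd.fst) (by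
      simp only [blockExec, work, Regs.set, CellExpr.eval, Regs.get, select_eq, valueExpr, part,
        drops, Interp.value, hy, hz])
      h4 (hlen 2) (by decide)
  have H6 : Runs o (block [(store, t1), (code, nextExpr), (clock, .snd clock), (t1, .nil),
      (t3, .nil), (vy, .nil), (vz, .nil)]) 240 _ (setInterp s S.step f.snd) :=
    Runs.of_block (s := work s S.code S.store S.step.table f
      S.step.store nil (Interp.value S.code.fst.fst y z (Interp.answer S.table y.toBits)) y z) (by
      simp only [blockExec, setInterp, work, Regs.set, CellExpr.eval, Regs.get, select_eq, nextExpr,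
        part, drops, Interp.step, Interp.next, hy]) (by decide)
  exact (H1.seq (H2.seq (H3.seq (H4.seq (H5.seq H6))))).mono (by omega)

theorem runs_clock (s : Regs) (S : Interp) (f : Cell) (h4 : s.t4 = nil) {h H F : ℕ}
    (hS : S.Bounded h H) (hH : H ≤ h) (h3 : 3 ≤ H) (hF : f.toBits.length = F) :
    Runs o (.loop clock.idx interpretRoutine) (F * (280 * (h + 2 * F) + 701) + 1)
      (setInterp s S f) (setInterp s (Interp.step^[F] S) nil) := by
  have := Runs.loop (o := o) (x := clock) (p := interpretRoutine) (c := 280 * (h + 2 * F) + 700)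
    (N := F) (fun j => setInterp s (Interp.step^[j] S) (snd^[j] f)) (fun j hj => ⟨?_, ?_⟩) ?_
  · simpa only [Function.iterate_zero_apply, iterate_snd_eq_nil hF.le] using this
  · simp only [setInterp, work, Regs.set, Regs.get]
    rw [isCons_iterate_snd, hF]
    exact hj
  · simp only [Function.iterate_succ_apply']
    exact (runs_interpret s _ _ h4 (hS.iterate hH h3 j)).mono (by omega)
  · simp only [setInterp, work, Regs.set, Regs.get]
    rw [isCons_iterate_snd, hF]
    exact lt_irrefl _

end Routine

namespace Routine

open Cell Reg

/-! ### The greedy choice as a program -/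

/-- One step of the greedy choice. The list `pre` holds the bits in reverse order, `shift` their
number in unary, and `rest` the number of the steps that remain. -/
def extendRoutine : Prog :=
  .seq (.seq (block [(t1, .nil), (t2, .cons .nil pre)]) revAppRoutine)
  (.seq (block [(store, .cons t1 (.cons .nil (.cons delta .nil))), (code, .cons prog .nil),
    (clock, .snd fuel), (t1, .nil)])
  (.seq (.loop clock.idx interpretRoutine)
  (.seq (.seq (block [(t1, .fst (.fst store)), (shift, .cons .nil shift), (t2, shift)])
    revAppRoutine)
  (.seq (.seq (block [(t2, .snd (.fst store))]) compareRoutine)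
  (block [(pre, .cons (.ite t3 .nil (.ite vy (.cons .nil .nil) .nil)) pre), (rest, .snd rest),
    (t3, .nil), (vy, .nil), (store, .nil), (code, .nil)])))))

theorem toBits_revApp (c d : Cell) : (revApp c d).toBits = c.toBits.reverse ++ d.toBits := by
  induction c generalizing d with
  | nil => rfl
  | cons a c _ ih =>
    rw [revApp, ih]; simp

theorem toNat_revApp_unary (j : ℕ) (c : Cell) :
    (revApp (unary j) c).toNat = 2 ^ j * c.toNat := by
  rw [toNat_eq_bitsVal, toBits_revApp, unary_eq_ofBits, toBits_ofBits, List.reverse_replicate,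
    bitsVal_replicate_append, toNat_eq_bitsVal]

theorem isLow_iff (j : ℕ) (c : Cell) : Rates.isLow j c = true ↔
    2 ^ j * c.fst.toNat ≤ c.snd.toNat ∨ ¬0 < c.snd.toNat := by
  rw [Rates.isLow, decide_eq_true_iff, toRat]
  rcases Nat.eq_zero_or_pos c.snd.toNat with h | h
  · simp [h]
  · simp only [h, not_true_eq_false, or_false]
    rw [div_le_iff₀ (by exact_mod_cast h), ← div_eq_inv_mul, le_div_iff₀ (by positivity), mul_comm]
    exact_mod_cast Iff.rfl

theorem length_toBits_snd (c : Cell) : c.snd.toBits.length = c.toBits.length - 1 := by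
  cases c <;> simp

/-- Registers in the greedy choice, after the string `w` has been found; `T` is the table, and `r`
holds the number of the steps that remain. -/
def setGreedy (s : Regs) (w : List Bool) (T r : Cell) : Regs :=
  work (((s.set pre (ofBits w.reverse)).set shift (unary w.length)).set rest r)
    nil nil T nil nil nil nil nil nil

theorem runs_block_revApp {l : List (Reg × CellExpr)} {s s₀ : Regs} {K R T f a b c d e : Cell}
    (h : blockExec l s₀ = work s K R T f a b c d e) {n m : ℕ} (hn : b.toBits.length ≤ n)
    (hm : blockCost l ≤ m) :
    Runs o (.seq (block l) revAppRoutine) (20 * n + m + 2) s₀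
      (work s K R T f (revApp b a) nil c d e) := by
  have h1 := runs_revApp (o := o) (work s K R T f a b c d e)
  simp only [work, Regs.set] at h1
  simp only [work, Regs.set] at h ⊢
  exact ((Runs.of_block h hm).seq h1).mono (by omega)

theorem bounded_start {p x d T : Cell} {h : ℕ} (hp : p.height ≤ h) (hx : x.height ≤ h)
    (hd : d.height ≤ h) (hT : ∀ z, (lookup T z).height ≤ h) :
    (Interp.start p x d T).Bounded (h + 1) h := by
  refine ⟨by simpa [Interp.start] using hp, fun z => ?_, hT⟩
  refine le_trans ?_ (Nat.le_succ h)
  match z with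
  | [] => exact hx
  | [true] => exact hd
  | false :: z => simp [Interp.start, lookup]
  | true :: b :: z => cases b <;> simp [Interp.start, lookup]

variable {P : Rates}

/-- What the registers have to hold during the greedy choice for the program `p`. -/
structure GreedyReady (P : Rates) (m : ℕ) (p : Cell) (s : Regs) : Prop where
  prog : s.prog = p
  delta : s.delta = ofRat (P.precision m)
  fuel : s.fuel.toBits.length = 2 ^ (P.b * P.level m)
  t4 : s.t4 = nil

/-- The comparison of the number `c` with `2 ^ (-j)`, where `j = w.length + 1`, is made between
`2 ^ j` times the numerator of `c` and its denominator. The multiplication puts `j` zeros in front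
of the digits. A denominator `0` means the number `0`, by the convention on division. -/
theorem runs_extend {m : ℕ} {p : Cell} {s : Regs} (hs : GreedyReady P m p s) {h : ℕ}
    (w : List Bool) (T r : Cell) (hp : p.height ≤ h) (hw : w.length + 2 ≤ h)
    (hd : (ofRat (P.precision m)).height ≤ h) (hT : ∀ z, (lookup T z).height ≤ h) (h3 : 3 ≤ h) :
    Runs o extendRoutine (2000 * ((P.clock m + 1) * (h + P.clock m))) (setGreedy s w T r)
      (setGreedy s (P.greedyStep m p (w, T)).1 (P.greedyStep m p (w, T)).2 r.snd) := by
  obtain ⟨hprog, hdelta, hfuel, ht4⟩ := hs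
  set F := P.clock m with hF
  set S := Interp.start p (ofBits (w ++ [false])) (ofRat (P.precision m)) T with hS
  set R := Interp.step^[F] S with hR
  have hSb : S.Bounded (h + 1) h :=
    bounded_start hp ((height_ofBits_le _).trans (by simp; omega)) hd hT
  have hRb := hSb.iterate (by omega) h3 F
  rw [← hR] at hRb
  have hout : R.store.fst.height ≤ h + 1 + 2 * F := hRb.store []
  have hA := (length_toBits_le_height _).trans ((height_fst_le _).trans hout)
  have hB := (length_toBits_le_height _).trans ((height_snd_le _).trans hout)
  have hclock : s.fuel.snd.toBits.length = F := by
    rw [length_toBits_snd, hfuel, hF, Rates.clock]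
  set s₁ := ((s.set pre (ofBits w.reverse)).set shift (unary w.length)).set rest r with hs₁
  set s₂ := ((s.set pre (ofBits w.reverse)).set shift (unary (w.length + 1))).set rest r with hs₂
  have ht4₁ : s₁.t4 = nil := by simpa only [hs₁, Regs.set] using ht4
  have H1 : Runs o _ (20 * h + 30 + 2) (setGreedy s w T r)
      (work s₁ nil nil T nil (revApp (ofBits (false :: w.reverse)) (ofBits [])) nil nil nil nil) :=
    runs_block_revApp (l := [(t1, .nil), (t2, .cons .nil pre)]) (s := s₁) (by
      simp only [blockExec, setGreedy, hs₁, work, Regs.set, CellExpr.eval, Regs.get, ofBits, ofBit])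
      (by simp; omega) (by decide)
  rw [revApp_ofBits, List.reverse_cons, List.reverse_reverse, List.append_nil] at H1
  have H2 : Runs o (block [(store, .cons t1 (.cons .nil (.cons delta .nil))),
      (code, .cons prog .nil), (clock, .snd fuel), (t1, .nil)]) 60 _
      (setInterp s₁ S s.fuel.snd) :=
    Runs.of_block (s := work s₁ nil nil T nil (ofBits (w ++ [false])) nil nil nil nil) (by
      simp only [blockExec, setInterp, hs₁, work, Regs.set, CellExpr.eval, Regs.get, hS,
        Interp.start, hprog, hdelta]) (by decide)
  have H3 := runs_clock (o := o) s₁ S s.fuel.snd ht4₁ hSb (by omega) h3 hclock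
  rw [← hR] at H3
  have H4 : Runs o _ (20 * h + 50 + 2) (setInterp s₁ R nil) (work s₂ R.code R.store R.table nil
      (revApp (unary (w.length + 1)) R.store.fst.fst) nil nil nil nil) :=
    runs_block_revApp (l := [(t1, .fst (.fst store)), (shift, .cons .nil shift), (t2, shift)])
      (s := s₂) (by
      simp only [blockExec, setInterp, hs₁, hs₂, work, Regs.set, CellExpr.eval, Regs.get, unary])
      (by simp; omega) (by decide)
  set A := revApp (unary (w.length + 1)) R.store.fst.fst with hAdef
  have hAl : A.toBits.length ≤ w.length + 1 + (h + 1 + 2 * F) := by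
    rw [hAdef, toBits_revApp, List.length_append, List.length_reverse, length_toBits_unary]
    omega
  obtain ⟨c, d, H5, hc, hd⟩ := runs_compare (o := o)
    (work s₂ R.code R.store R.table nil A R.store.fst.snd nil nil nil)
  simp only [work, setCompare, Regs.set] at H5 hc hd
  have H5' : Runs o (block [(t2, .snd (.fst store))]) 20
      (work s₂ R.code R.store R.table nil A nil nil nil nil)
      (work s₂ R.code R.store R.table nil A R.store.fst.snd nil nil nil) :=
    Runs.of_block (by
      simp only [blockExec, work, Regs.set, CellExpr.eval, Regs.get]) (by decide)
  have hbit : (if c.isCons = true then nil else if d.isCons = true then Cell.cons nil nil else nil) =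
      ofBit (!Rates.isLow (w.length + 1) R.store.fst) := by
    rw [hAdef, toNat_revApp_unary] at hc
    have := isLow_iff (w.length + 1) R.store.fst
    rw [← hc, ← hd] at this
    cases hl : Rates.isLow (w.length + 1) R.store.fst <;> rw [hl] at this
    · simp only [Bool.false_eq_true, false_iff, not_or, not_not] at this
      rw [if_neg this.1, if_pos this.2]; rfl
    · simp only [true_iff] at this
      rcases this with h | h
      · rw [if_pos h]; rfl
      · rw [if_neg h, ite_self]; rfl
  have H6 : Runs o (block [(pre, .cons (.ite t3 .nil (.ite vy (.cons .nil .nil) .nil)) pre),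
      (rest, .snd rest), (t3, .nil), (vy, .nil), (store, .nil), (code, .nil)]) 60
      (work s₂ R.code R.store R.table nil nil nil c d nil)
      (setGreedy s (P.greedyStep m p (w, T)).1 (P.greedyStep m p (w, T)).2 r.snd) :=
    Runs.of_block (by
      have e1 : (P.greedyStep m p (w, T)).1.reverse =
          (!Rates.isLow (w.length + 1) R.store.fst) :: w.reverse := by
        rw [Rates.greedyStep, List.reverse_append]; rfl
      have e2 : (P.greedyStep m p (w, T)).1.length = w.length + 1 := by
        rw [Rates.greedyStep, List.length_append]; rfl
      have e3 : (P.greedyStep m p (w, T)).2 = R.table := rfl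
      simp only [blockExec, setGreedy, hs₂, work, Regs.set, CellExpr.eval, Regs.get, select_eq, hbit,
        e1, e2, e3, ofBits]) (by decide)
  have H45 : Runs o _ (20 + (60 * (A.toBits.length + R.store.fst.snd.toBits.length) + 20) + 1)
      (work s₂ R.code R.store R.table nil A nil nil nil nil)
      (work s₂ R.code R.store R.table nil nil nil c d nil) :=
    H5'.seq (by simpa only [work, Regs.set] using H5)
  refine (H1.seq (H2.seq (H3.seq (H4.seq (H45.seq H6))))).mono ?_
  have e : F * (280 * (h + 1 + 2 * F) + 701) = 280 * (F * h) + 560 * (F * F) + 981 * F := by ring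
  have e' : 2000 * ((F + 1) * (h + F)) = 2000 * (F * h) + 2000 * (F * F) + 2000 * F + 2000 * h := by
    ring
  omega

theorem height_le_of_freezes {T T' : Cell} {h : ℕ} (h3 : 3 ≤ h) (hf : Rates.Freezes T T')
    (hT : ∀ z, (lookup T z).height ≤ h) (z : List Bool) : (lookup T' z).height ≤ h := by
  rcases hf z with e | ⟨-, e⟩
  · rw [e]; exact hT z
  · rw [e, ofRat_zero]
    simpa [one] using h3

theorem runs_greedy {m : ℕ} {p : Cell} {s : Regs} (hs : GreedyReady P m p s) {h : ℕ}
    (T : Cell) (hp : p.height ≤ h) (hw : m + 2 ≤ h)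
    (hd : (ofRat (P.precision m)).height ≤ h) (hT : ∀ z, (lookup T z).height ≤ h) (h3 : 3 ≤ h) :
    Runs o (.loop rest.idx extendRoutine)
      (P.bound m * (2000 * ((P.clock m + 1) * (h + P.clock m)) + 1) + 1)
      (setGreedy s [] T (unary (P.bound m)))
      (setGreedy s (P.greedy m p T).1 (P.greedy m p T).2 nil) := by
  have := Runs.loop (o := o) (x := rest) (p := extendRoutine)
    (c := 2000 * ((P.clock m + 1) * (h + P.clock m))) (N := P.bound m)
    (fun j => setGreedy s ((P.greedyStep m p)^[j] ([], T)).1 ((P.greedyStep m p)^[j] ([], T)).2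
      (unary (P.bound m - j))) (fun j hj => ⟨?_, ?_⟩) ?_
  · simp only [Function.iterate_zero_apply, Nat.sub_zero, Nat.sub_self] at this
    exact this
  · simp only [setGreedy, work, Regs.set, Regs.get]
    rw [isCons_unary]
    omega
  · have h1 := runs_extend (o := o) hs (h := h) ((P.greedyStep m p)^[j] ([], T)).1
      ((P.greedyStep m p)^[j] ([], T)).2 (unary (P.bound m - j)) hp
      (by
        rw [Rates.length_greedyStep]
        have : P.bound m ≤ m := Nat.sub_le _ _
        simp only [List.length_nil]; omega) hd
      (height_le_of_freezes h3 (Rates.freezes_greedyStep m p ([], T) j) hT) h3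
    rw [unary_snd, Nat.sub_sub] at h1
    simp only [Function.iterate_succ_apply']
    exact h1
  · simp only [setGreedy, work, Regs.set, Regs.get]
    rw [Nat.sub_self]
    exact Bool.false_ne_true

/-! ### Choosing a fresh string as a program -/

/-- One step of the search for a fresh string. -/
def pickRoutine : Prog :=
  .seq (.seq (block [(t1, .fst cursor), (t2, pre)]) revAppRoutine)
  (.seq (.seq (block [(vz, t1), (t2, t1), (t1, tab)]) lookupRoutine)
  (block [(found, .ite t1 found vz), (t1, .nil), (vz, .nil), (cursor, .snd cursor)]))

/-- Registers in the search for a fresh string, after `v` has been found, while the strings `c`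
remain to be tried. -/
def setPick (s : Regs) (v : List Bool) (T c : Cell) : Regs :=
  work ((s.set found (ofBits v)).set cursor c) nil nil T nil nil nil nil nil nil

theorem runs_pick {s : Regs} {w : List Bool} (hs : s.pre = ofBits w.reverse) (T : Cell) {m : ℕ}
    (l : List (List Bool)) (hl : ∀ y ∈ l, w.length + y.length ≤ m) (v : List Bool) :
    Runs o (.loop cursor.idx pickRoutine) (l.length * (46 * m + 131) + 1)
      (setPick s v T (ofStrings l))
      (setPick s (l.foldl (fun f y => if (lookup T (w ++ y)).isCons = true then f else w ++ y) v)
        T nil) := by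
  induction l generalizing v with
  | nil => exact (Runs.loop_nil (by
      simp only [setPick, work, Regs.set, Regs.get]; exact Bool.false_ne_true)).mono (by omega)
  | cons y l ih =>
    have hy := hl y (by simp)
    have H1 : Runs o _ (20 * m + 30 + 2) (setPick s v T (ofStrings (y :: l)))
        (work ((s.set found (ofBits v)).set cursor (ofStrings (y :: l))) nil nil T nil
          (revApp (ofBits w.reverse) (ofBits y)) nil nil nil nil) :=
      runs_block_revApp (l := [(t1, .fst cursor), (t2, pre)])
        (s := (s.set found (ofBits v)).set cursor (ofStrings (y :: l))) (by
        simp only [blockExec, setPick, work, Regs.set, CellExpr.eval, Regs.get, hs, ofStrings,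
          List.map_cons, ofList_cons, fst_cons]) (by simp; omega) (by decide)
    rw [revApp_ofBits, List.reverse_reverse] at H1
    have H2 : Runs o _ (26 * m + 30 + 11) (work ((s.set found (ofBits v)).set cursor
          (ofStrings (y :: l))) nil nil T nil (ofBits (w ++ y)) nil nil nil nil)
        (work ((s.set found (ofBits v)).set cursor (ofStrings (y :: l))) nil nil T nil
          (lookup T (ofBits (w ++ y)).toBits) nil nil nil (ofBits (w ++ y))) :=
      runs_block_lookup (l := [(vz, t1), (t2, t1), (t1, tab)])
        (s := (s.set found (ofBits v)).set cursor (ofStrings (y :: l))) (by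
        simp only [blockExec, work, Regs.set, CellExpr.eval, Regs.get]) (by simp; omega) (by decide)
    rw [toBits_ofBits] at H2
    have H3 : Runs o (block [(found, .ite t1 found vz), (t1, .nil), (vz, .nil),
        (cursor, .snd cursor)]) 40 (work ((s.set found (ofBits v)).set cursor
          (ofStrings (y :: l))) nil nil T nil (lookup T (w ++ y)) nil nil nil (ofBits (w ++ y)))
        (setPick s (if (lookup T (w ++ y)).isCons = true then v else w ++ y) T (ofStrings l)) :=
      Runs.of_block (by
        simp only [blockExec, setPick, work, Regs.set, CellExpr.eval, Regs.get, select_eq, ofStrings,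
          List.map_cons, ofList_cons, snd_cons, apply_ite ofBits]) (by decide)
    refine (Runs.loop_cons (t := 46 * m + 130) ?_ ((H1.seq (H2.seq H3)).mono (by omega))
      (ih (fun y hy => hl y (by simp [hy])) _)).mono ?_
    · simp only [setPick, work, Regs.set, Regs.get]; rfl
    · rw [List.length_cons, Nat.add_mul]; omega

end Routine

namespace Routine

open Cell Reg

variable {P : Rates}

/-! ### The stages as a program -/

/-- Add the program with the first code in the list `codes` to the table. -/
def codeRoutine : Prog :=
  .seq (.seq (block [(t1, .nil), (t2, .fst codes)]) decodeRoutine)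
  (.seq (block [(prog, .fst t1), (t1, .nil), (pre, .nil), (shift, .nil), (rest, len)])
  (.seq (.loop rest.idx extendRoutine)
  (.seq (block [(found, .nil), (cursor, cands)])
  (.seq (.loop cursor.idx pickRoutine)
  (.seq (.seq (block [(t1, tab), (t2, found), (t3, .cons (.cons (.cons .nil .nil) .nil) den)])
    insertRoutine)
  (block [(tab, t1), (t1, .nil), (t3, .nil), (prog, .nil), (pre, .nil), (shift, .nil),
    (found, .nil), (codes, .snd codes)]))))))

/-- Registers between the additions of two programs in stage `m`. The list `c` of the codes that
remain and the table `T` vary. -/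
def codeRegs (P : Rates) (m : ℕ) (x td c T : Cell) : Regs where
  inp := x
  tab := T
  todo := td
  una := unary m
  drop := nil
  codes := c
  fuel := ofStrings (strings (P.b * P.level m))
  cands := ofStrings (strings (P.free m))
  len := unary (P.bound m)
  den := ofBits (List.replicate (P.level m) false ++ [true])
  delta := ofRat (P.precision m)
  prog := nil
  pre := nil
  shift := nil
  rest := nil
  found := nil
  cursor := nil
  clock := nil
  code := nil
  store := nil
  vy := nil
  vz := nil
  t1 := nil
  t2 := nil
  t3 := nil
  t4 := nil

theorem length_fresh_le {T : Cell} {w : List Bool} {l : List (List Bool)} {n : ℕ}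
    (h : ∀ y ∈ l, w.length + y.length ≤ n) : (Rates.fresh T w l).length ≤ n := by
  unfold Rates.fresh
  induction l using List.reverseRecOn with
  | nil => simp
  | append_singleton l y ih =>
    rw [List.foldl_append, List.foldl_cons, List.foldl_nil]
    split_ifs
    · exact ih fun y hy => h y (by simp [hy])
    · rw [List.length_append]; exact h y (by simp)

theorem height_ofRat_inv_two_pow_le (j : ℕ) : (ofRat (2 ^ j)⁻¹).height ≤ j + 3 := by
  rw [ofRat_inv_two_pow, height_cons]
  have := height_ofBits_le (List.replicate j false ++ [true])
  simp only [List.length_append, List.length_replicate, List.length_singleton] at this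
  simp only [one, height_cons, height_nil]
  omega

theorem runs_code (ha : P.a ≤ P.D) {m : ℕ} (x td T : Cell) (v : List Bool)
    (l : List (List Bool)) (hv : v.length = P.level m)
    (hT : ∀ z, (lookup T z).height ≤ 2 * m + 5) :
    Runs o codeRoutine (20000 * ((m + 1) ^ 2 * ((P.clock m + 1) ^ 2 + 2 ^ P.free m)))
      (codeRegs P m x td (ofStrings (v :: l)) T)
      (codeRegs P m x td (ofStrings l) (P.addProgram m T v)) := by
  have hlev : P.level m ≤ m := Nat.div_le_self _ _
  have hsum := Rates.bound_add_free ha m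
  set h := 2 * m + 5 with hh
  set S := codeRegs P m x td (ofStrings (v :: l)) T with hS
  set s₁ := S.set prog (decode v) with hs₁
  set w := (P.greedy m (decode v) T).1 with hw
  set T' := (P.greedy m (decode v) T).2 with hT'
  have hwl : w.length = P.bound m := Rates.length_greedy m _ T
  set s₂ := ((s₁.set pre (ofBits w.reverse)).set shift (unary w.length)).set rest nil with hs₂
  set f := Rates.fresh T' w (strings (P.free m)) with hf
  set s₃ := (s₂.set found (ofBits f)).set cursor nil with hs₃
  have hl : ∀ y ∈ strings (P.free m), w.length + y.length ≤ m := by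
    intro y hy
    rw [hwl, mem_strings.1 hy, hsum]
  have H1 := runs_decode (o := o) ((S.set t1 nil).set t2 (ofBits v))
  have H1' : Runs o (block [(t1, .nil), (t2, .fst codes)]) 20 S ((S.set t1 nil).set t2 (ofBits v)) :=
    Runs.of_block (by
      simp only [blockExec, hS, codeRegs, Regs.set, CellExpr.eval, Regs.get, ofStrings,
        List.map_cons, ofList_cons, fst_cons]) (by decide)
  simp only [hS, codeRegs, Regs.set, toBits_ofBits, hv] at H1 H1'
  have H2 : Runs o (block [(prog, .fst t1), (t1, .nil), (pre, .nil), (shift, .nil), (rest, len)]) 50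
      (S.set t1 (v.foldl pushBit nil)) (setGreedy s₁ [] T (unary (P.bound m))) :=
    Runs.of_block (by
      simp only [blockExec, hs₁, hS, codeRegs, setGreedy, work, Regs.set, CellExpr.eval, Regs.get,
        List.reverse_nil, ofBits, List.length_nil, unary, decode]) (by decide)
  simp only [hS, codeRegs, Regs.set] at H2
  have H3 := runs_greedy (o := o) (P := P) (m := m) (p := decode v) (s := s₁) (h := h)
    ⟨by simp only [hs₁, hS, Regs.set], by simp only [hs₁, hS, codeRegs, Regs.set], by
      simp only [hs₁, hS, codeRegs, Regs.set, length_toBits_ofStrings, length_strings],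
      by simp only [hs₁, hS, codeRegs, Regs.set]⟩ T
    ((height_decode_le v).trans (by omega)) (by omega)
    ((height_ofRat_inv_two_pow_le _).trans (by omega)) hT (by omega)
  have H4 : Runs o (block [(found, .nil), (cursor, cands)]) 20 (setGreedy s₁ w T' nil)
      (setPick s₂ [] T' (ofStrings (strings (P.free m)))) :=
    Runs.of_block (by
      simp only [blockExec, hs₂, hs₁, hS, codeRegs, setGreedy, setPick, work, Regs.set,
        CellExpr.eval, Regs.get, ofBits]) (by decide)
  have H5 := runs_pick (o := o) (s := s₂) (w := w) (by simp only [hs₂, Regs.set]) T' _ hl []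
  rw [length_strings] at H5
  have H6 : Runs o _ (100 * m + 50 + 21) (setPick s₂ f T' nil)
      (work s₃ nil nil T' nil (insert T' (ofBits f).toBits (ofRat (P.weight m))) nil
        (ofRat (P.weight m)) nil nil) :=
    runs_block_insert (l := [(t1, tab), (t2, found),
        (t3, .cons (.cons (.cons .nil .nil) .nil) den)]) (by
      simp only [blockExec, hs₃, hs₂, hs₁, hS, codeRegs, setPick, work, Regs.set,
        CellExpr.eval, Regs.get, Rates.weight, ofRat_inv_two_pow, one])
      (by simp only [hs₃, hs₂, hs₁, hS, codeRegs, Regs.set])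
      (by rw [toBits_ofBits]; exact length_fresh_le hl) (by decide)
  rw [toBits_ofBits] at H6
  have H7 : Runs o (block [(tab, t1), (t1, .nil), (t3, .nil), (prog, .nil), (pre, .nil),
      (shift, .nil), (found, .nil), (codes, .snd codes)]) 60
      (work s₃ nil nil T' nil (insert T' f (ofRat (P.weight m))) nil (ofRat (P.weight m)) nil nil)
      (codeRegs P m x td (ofStrings l) (P.addProgram m T v)) :=
    Runs.of_block (by
      have e : P.addProgram m T v = insert T' f (ofRat (P.weight m)) := rfl
      simp only [blockExec, hs₃, hs₂, hs₁, hS, codeRegs, work, Regs.set,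
        CellExpr.eval, Regs.get, e, ofStrings, List.map_cons, ofList_cons, snd_cons]) (by decide)
  refine ((H1'.seq H1).seq (H2.seq (H3.seq (H4.seq (H5.seq (H6.seq H7)))))).mono ?_
  have hb : P.bound m ≤ m := Nat.sub_le _ _
  generalize P.clock m = F, 2 ^ P.free m = G at *
  have h1 : P.bound m * (2000 * ((F + 1) * (h + F)) + 1) ≤
      m * (2000 * ((F + 1) * (h + F)) + 1) := Nat.mul_le_mul_right _ hb
  have h2 : (F + 1) * (h + F) ≤ (F + 1) ^ 2 * h := by
    rw [pow_two, mul_assoc]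
    refine Nat.mul_le_mul_left _ ?_
    nlinarith [Nat.zero_le (F * m)]
  have h3 : m * (2000 * ((F + 1) * (h + F)) + 1) ≤ m * (2000 * ((F + 1) ^ 2 * h) + 1) := by gcongr
  have h4 : 1 ≤ (F + 1) ^ 2 := Nat.one_le_pow _ _ (by omega)
  generalize (F + 1) ^ 2 = B at *
  have h5 : m * (2000 * (B * h) + 1) + G * (46 * m + 131) + 300 * (m + 1) ≤
      20000 * ((m + 1) ^ 2 * (B + G)) := by
    rw [hh]
    have : (m + 1) * 1 ≤ (m + 1) ^ 2 * B :=
      Nat.mul_le_mul (Nat.le_self_pow two_ne_zero _) h4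
    nlinarith [Nat.zero_le (m ^ 2 * G), Nat.zero_le (m * G), Nat.zero_le (m ^ 2 * B), Nat.zero_le (m * B)]
  omega

end Routine

namespace Routine

open Cell Reg

variable {P : Rates}

/-- A block of assignments, followed by `n` doublings of the list of strings in `t1`. -/
def doubleBlock (l : List (Reg × CellExpr)) (n : ℕ) : Prog :=
  .seq (block l) (iter doubleRoutine n)

/-- Increase the level by one in the preparation of a stage: the lists of all strings of the lengths
`j`, `b * j` and `a * j` in `codes`, `fuel` and `cands` pass from `j` to `j + 1`, and so do the
unary number `m - a * j` in `len` and the binary number `2 ^ j` in `den`. -/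
def levelRoutine (P : Rates) : Prog :=
  .seq (doubleBlock [(drop, drops drop P.D), (len, drops len P.a), (den, .cons .nil den),
    (t1, codes)] 1)
  (.seq (doubleBlock [(codes, t1), (t1, fuel)] P.b)
  (.seq (doubleBlock [(fuel, t1), (t1, cands)] P.a) (block [(cands, t1), (t1, .nil)])))

/-- A stage of the construction. The register `una` holds its number in unary. -/
def stageRoutine (P : Rates) : Prog :=
  .seq (block [(drop, drops una (P.D - 1)), (codes, .cons .nil .nil), (fuel, .cons .nil .nil),
    (cands, .cons .nil .nil), (len, una), (den, .cons (.cons .nil .nil) .nil)])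
  (.seq (.loop drop.idx (levelRoutine P))
  (.seq (.seq (block [(drop, .nil), (t1, .cons (.cons .nil .nil) .nil), (t2, len)]) revAppRoutine)
  (.seq (block [(delta, .cons (.cons (.cons .nil .nil) .nil) t1), (t1, .nil)])
  (.seq (.loop codes.idx codeRoutine)
  (block [(todo, .snd todo), (una, .cons .nil una), (fuel, .nil), (cands, .nil), (len, .nil),
    (den, .nil), (delta, .nil)])))))

/-- Registers between two stages: `m` is the number of the next stage. -/
def stageRegs (m : ℕ) (x td T : Cell) : Regs where
  inp := x
  tab := T
  todo := td
  una := unary m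
  drop := nil
  codes := nil
  fuel := nil
  cands := nil
  len := nil
  den := nil
  delta := nil
  prog := nil
  pre := nil
  shift := nil
  rest := nil
  found := nil
  cursor := nil
  clock := nil
  code := nil
  store := nil
  vy := nil
  vz := nil
  t1 := nil
  t2 := nil
  t3 := nil
  t4 := nil

/-- Registers in the preparation of stage `m`, at level `j`. -/
def levelRegs (P : Rates) (m : ℕ) (x td T : Cell) (j : ℕ) : Regs :=
  ((((((stageRegs m x td T).set drop (unary (m - (P.D - 1) - P.D * j))).set codes
    (ofStrings (strings j))).set fuel (ofStrings (strings (P.b * j)))).set cands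
    (ofStrings (strings (P.a * j)))).set len (unary (m - P.a * j))).set den
    (ofBits (List.replicate j false ++ [true]))

theorem runs_doubleBlock {l : List (Reg × CellExpr)} {s₀ s : Regs} {i : ℕ} {c : Cell}
    (hc : c = ofStrings (strings i)) (h : blockExec l s₀ = s.set t1 c) (h2 : s.t2 = nil) (n : ℕ)
    {t : ℕ} (ht : blockCost l ≤ t) :
    Runs o (doubleBlock l n) (t + 53 * n * (2 ^ (n + i) + 1) + 2) s₀
      (s.set t1 (ofStrings (strings (n + i)))) := by
  have h1 := runs_iter_double (o := o) (s.set t1 c) (strings i) hc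
    (by simpa only [Regs.set] using h2) n
  rw [iterate_double_strings, length_strings, ← pow_add] at h1
  refine ((Runs.of_block h ht).seq h1).mono (by omega)

/-- The time that an increase of the level takes, up to the powers of two. -/
def levelTime (P : Rates) : ℕ := 2 * P.D + 2 * P.a + 200 + 53 * (P.a + P.b + 1)

theorem runs_level {m : ℕ} (x td T : Cell) {j k : ℕ} (hj : j < k) :
    Runs o (levelRoutine P) (levelTime P * (2 ^ k + 2 ^ (P.b * k) + 2 ^ (P.a * k)))
      (levelRegs P m x td T j) (levelRegs P m x td T (j + 1)) := by
  set S := levelRegs P m x td T j with hS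
  set s₁ := ((S.set drop (unary (m - (P.D - 1) - P.D * j - P.D))).set len
    (unary (m - P.a * j - P.a))).set den (ofBits (List.replicate (j + 1) false ++ [true])) with hs₁
  set s₂ := s₁.set codes (ofStrings (strings (1 + j))) with hs₂
  set s₃ := s₂.set fuel (ofStrings (strings (P.b + P.b * j))) with hs₃
  have H1 := runs_doubleBlock (o := o) (l := [(drop, drops drop P.D), (len, drops len P.a),
      (den, .cons .nil den), (t1, codes)]) (s₀ := S) (s := s₁) (i := j) rfl (by
      simp only [blockExec, hs₁, hS, levelRegs, stageRegs, Regs.set, CellExpr.eval, Regs.get,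
        eval_drops, iterate_snd_unary, List.replicate_succ, List.cons_append, ofBits, ofBit])
      (by simp only [hs₁, hS, levelRegs, stageRegs, Regs.set]) 1
      (t := 2 * P.D + 2 * P.a + 30) (by
        simp only [blockCost, CellExpr.cost, cost_drops]; omega)
  have H2 := runs_doubleBlock (o := o) (l := [(codes, t1), (t1, fuel)])
      (s₀ := s₁.set t1 (ofStrings (strings (1 + j)))) (s := s₂) (i := P.b * j) rfl (by
      simp only [blockExec, hs₂, hs₁, hS, levelRegs, stageRegs, Regs.set, CellExpr.eval, Regs.get])
      (by simp only [hs₂, hs₁, hS, levelRegs, stageRegs, Regs.set]) P.b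
      (t := 20) (by decide)
  have H3 := runs_doubleBlock (o := o) (l := [(fuel, t1), (t1, cands)])
      (s₀ := s₂.set t1 (ofStrings (strings (P.b + P.b * j)))) (s := s₃) (i := P.a * j) rfl (by
      simp only [blockExec, hs₃, hs₂, hs₁, hS, levelRegs, stageRegs, Regs.set, CellExpr.eval,
        Regs.get])
      (by simp only [hs₃, hs₂, hs₁, hS, levelRegs, stageRegs, Regs.set]) P.a
      (t := 20) (by decide)
  have H4 : Runs o (block [(cands, t1), (t1, .nil)]) 20
      (s₃.set t1 (ofStrings (strings (P.a + P.a * j)))) (levelRegs P m x td T (j + 1)) :=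
    Runs.of_block (by
      have e1 : m - (P.D - 1) - P.D * j - P.D = m - (P.D - 1) - P.D * (j + 1) := by
        rw [Nat.mul_add, mul_one]; omega
      have e2 : m - P.a * j - P.a = m - P.a * (j + 1) := by
        rw [Nat.mul_add, mul_one]; omega
      have e3 : P.b + P.b * j = P.b * (j + 1) := by ring
      have e4 : P.a + P.a * j = P.a * (j + 1) := by ring
      simp only [blockExec, hs₃, hs₂, hs₁, hS, levelRegs, stageRegs, Regs.set, CellExpr.eval,
        Regs.get, e1, e2, e3, e4, Nat.add_comm 1 j]) (by decide)
  refine (H1.seq (H2.seq (H3.seq H4))).mono ?_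
  have p1 : 2 ^ (1 + j) ≤ 2 ^ k := Nat.pow_le_pow_right two_pos (by omega)
  have p2 : 2 ^ (P.b + P.b * j) ≤ 2 ^ (P.b * k) := Nat.pow_le_pow_right two_pos (by
    rw [Nat.add_comm, ← Nat.mul_succ]; exact Nat.mul_le_mul_left _ hj)
  have p3 : 2 ^ (P.a + P.a * j) ≤ 2 ^ (P.a * k) := Nat.pow_le_pow_right two_pos (by
    rw [Nat.add_comm, ← Nat.mul_succ]; exact Nat.mul_le_mul_left _ hj)
  have q1 : 1 ≤ 2 ^ (1 + j) := Nat.one_le_two_pow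
  have q2 : 1 ≤ 2 ^ (P.b * k) := Nat.one_le_two_pow
  have q3 : 1 ≤ 2 ^ (P.a * k) := Nat.one_le_two_pow
  have p1' : 53 * 1 * (2 ^ (1 + j) + 1) ≤ 53 * 1 * (2 ^ k + 1) := by gcongr
  have p2' : 53 * P.b * (2 ^ (P.b + P.b * j) + 1) ≤ 53 * P.b * (2 ^ (P.b * k) + 1) := by gcongr
  have p3' : 53 * P.a * (2 ^ (P.a + P.a * j) + 1) ≤ 53 * P.a * (2 ^ (P.a * k) + 1) := by gcongr
  generalize 2 ^ k = A, 2 ^ (P.b * k) = B, 2 ^ (P.a * k) = C at *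
  have hA : 1 ≤ A := q1.trans p1
  rw [levelTime]
  have b1 : P.b * 1 ≤ P.b * A := Nat.mul_le_mul_left _ hA
  have a1 : P.a * 1 ≤ P.a * A := Nat.mul_le_mul_left _ hA
  have d1 : P.D * 1 ≤ P.D * A := Nat.mul_le_mul_left _ hA
  nlinarith [Nat.zero_le (P.b * C), Nat.zero_le (P.a * B), Nat.zero_le (P.D * B), Nat.zero_le (P.D * C)]

theorem height_lookup_table_le (hP : P.Good) {m : ℕ} (T : Cell)
    (hT : P.Extends m (P.table m) T) (z : List Bool) : (lookup T z).height ≤ 2 * m + 5 := by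
  have h0 : (ofRat 0).height ≤ 2 * m + 5 := by rw [ofRat_zero]; simp [one]
  have hw : ∀ i ≤ m, (ofRat (P.weight i)).height ≤ 2 * m + 5 := by
    intro i hi
    refine (height_ofRat_inv_two_pow_le _).trans ?_
    have : P.level i ≤ i := Nat.div_le_self _ _
    omega
  rcases hT z with h | ⟨-, h | ⟨-, h⟩⟩
  · rw [h]
    rcases Rates.lookup_table_eq hP m z with h | h | ⟨h1, h⟩ <;> rw [h]
    · simp
    · exact h0
    · exact hw _ h1.le
  · rw [h]; exact h0
  · rw [h]; exact hw m le_rfl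

/-- The time that the addition of a program takes. -/
def codeTime (P : Rates) (m : ℕ) : ℕ :=
  20000 * ((m + 1) ^ 2 * ((P.clock m + 1) ^ 2 + 2 ^ P.free m))

theorem runs_codes (hP : P.Good) {m : ℕ} (x td : Cell) :
    Runs o (.loop codes.idx codeRoutine) (2 ^ P.level m * (codeTime P m + 1) + 1)
      (codeRegs P m x td (ofStrings (strings (P.level m))) (P.table m))
      (codeRegs P m x td nil (P.table (m + 1))) := by
  have hcount := (Rates.count_table_le hP (le_refl m)).1
  suffices ∀ l₂ l₁ : List (List Bool), l₁ ++ l₂ = strings (P.level m) →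
      Runs o (.loop codes.idx codeRoutine) (l₂.length * (codeTime P m + 1) + 1)
        (codeRegs P m x td (ofStrings l₂) (l₁.foldl (P.addProgram m) (P.table m)))
        (codeRegs P m x td nil (P.table (m + 1))) by
    have := this (strings (P.level m)) [] rfl
    rwa [length_strings] at this
  intro l₂
  induction l₂ with
  | nil =>
    intro l₁ h
    rw [List.append_nil] at h
    subst h
    refine (Runs.loop_nil ?_).mono (by omega)
    simp only [codeRegs, Regs.get]
    exact Bool.false_ne_true
  | cons v l₂ ih =>
    intro l₁ h
    have h' := ih (l₁ ++ [v]) (by rw [← h, List.append_assoc]; rfl)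
    rw [List.foldl_append, List.foldl_cons, List.foldl_nil] at h'
    have hv : v.length = P.level m := mem_strings.1 (by rw [← h]; simp)
    have hl : l₁.length ≤ 2 ^ P.level m := by
      rw [← length_strings, ← h, List.length_append]; omega
    refine (Runs.loop_cons (t := codeTime P m) ?_ (runs_code hP.free_le x td _ v l₂ hv
      (height_lookup_table_le hP _ (Rates.stageInv_foldl hP hcount l₁ hl).1.ext)) h').mono ?_
    · simp only [codeRegs, Regs.get]; rfl
    · rw [List.length_cons, Nat.add_mul]; omega

/-- A bound for the time that a stage takes. -/
def stageTime (P : Rates) (m : ℕ) : ℕ :=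
  (200000 + 2 * P.D + 6 * levelTime P) *
    ((m + 1) ^ 2 * (2 ^ P.level m * (2 ^ (2 * (P.b * P.level m)) + 2 ^ (P.a * P.level m))))

theorem runs_stage (hP : P.Good) {m : ℕ} (x td : Cell) :
    Runs o (stageRoutine P) (stageTime P m) (stageRegs m x td (P.table m))
      (stageRegs (m + 1) x td.snd (P.table (m + 1))) := by
  set S := stageRegs m x td (P.table m) with hS
  have H1 : Runs o (block [(drop, drops una (P.D - 1)), (codes, .cons .nil .nil),
      (fuel, .cons .nil .nil), (cands, .cons .nil .nil), (len, una),
      (den, .cons (.cons .nil .nil) .nil)]) (2 * P.D + 60) S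
      (levelRegs P m x td (P.table m) 0) := by
    refine Runs.of_block ?_ (by simp only [blockCost, CellExpr.cost, cost_drops]; omega)
    have e : ofStrings (strings 0) = .cons nil nil := rfl
    have e' : ofBits (List.replicate 0 false ++ [true]) = .cons (.cons nil nil) nil := rfl
    simp only [blockExec, hS, levelRegs, stageRegs, Regs.set, CellExpr.eval, Regs.get, mul_zero,
      Nat.sub_zero, e, e', eval_drops, iterate_snd_unary]
  have H2 := Runs.loop (o := o) (x := drop) (p := levelRoutine P) (N := P.level m)
    (levelRegs P m x td (P.table m)) (fun j hj => ⟨?_, runs_level x td _ hj⟩) ?_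
  · have H3 : Runs o _ (20 * m + 40 + 2) (levelRegs P m x td (P.table m) (P.level m))
        (work (((codeRegs P m x td (ofStrings (strings (P.level m))) (P.table m))).set delta nil) nil
          nil (P.table m) nil (revApp (unary (P.bound m)) (.cons (.cons nil nil) nil)) nil nil nil
          nil) :=
      runs_block_revApp (l := [(drop, .nil), (t1, .cons (.cons .nil .nil) .nil), (t2, len)]) (by
        simp only [blockExec, levelRegs, stageRegs, codeRegs, work, Regs.set, CellExpr.eval,
          Regs.get, Rates.free, Rates.bound])
        (by rw [length_toBits_unary]; exact Nat.sub_le _ _) (by decide)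
    have H4 : Runs o (block [(delta, .cons (.cons (.cons .nil .nil) .nil) t1), (t1, .nil)]) 30
        (work (((codeRegs P m x td (ofStrings (strings (P.level m))) (P.table m))).set delta nil) nil
          nil (P.table m) nil (revApp (unary (P.bound m)) (.cons (.cons nil nil) nil)) nil nil nil
          nil)
        (codeRegs P m x td (ofStrings (strings (P.level m))) (P.table m)) :=
      Runs.of_block (by
        have e : Cell.cons (.cons (.cons nil nil) nil)
            (revApp (unary (P.bound m)) (.cons (.cons nil nil) nil)) = ofRat (P.precision m) := by
          have := revApp_ofBits (List.replicate (P.bound m) false) [true]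
          rw [← unary_eq_ofBits, List.reverse_replicate] at this
          rw [Rates.precision, ofRat_inv_two_pow, ← this]; rfl
        simp only [blockExec, codeRegs, work, Regs.set, CellExpr.eval, Regs.get, e]) (by decide)
    have H6 : Runs o (block [(todo, .snd todo), (una, .cons .nil una), (fuel, .nil), (cands, .nil),
        (len, .nil), (den, .nil), (delta, .nil)]) 50 (codeRegs P m x td nil (P.table (m + 1)))
        (stageRegs (m + 1) x td.snd (P.table (m + 1))) :=
      Runs.of_block (by
        simp only [blockExec, codeRegs, stageRegs, Regs.set, CellExpr.eval, Regs.get, unary])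
        (by decide)
    refine (H1.seq (H2.seq (H3.seq (H4.seq ((runs_codes hP x td).seq H6))))).mono ?_
    have hk : P.level m ≤ m := Nat.div_le_self _ _
    have hc : P.clock m + 1 = 2 ^ (P.b * P.level m) := Nat.sub_add_cancel Nat.one_le_two_pow
    have hc2 : (2 ^ (P.b * P.level m)) ^ 2 = 2 ^ (2 * (P.b * P.level m)) := by
      rw [← pow_mul, Nat.mul_comm 2]
    rw [codeTime, stageTime, hc, Rates.free, hc2]
    have hB : 2 ^ (P.b * P.level m) ≤ 2 ^ (2 * (P.b * P.level m)) :=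
      Nat.pow_le_pow_right two_pos (by omega)
    have q0 : 1 ≤ 2 ^ P.level m := Nat.one_le_two_pow
    have q1 : 1 ≤ 2 ^ (2 * (P.b * P.level m)) := Nat.one_le_two_pow
    generalize 2 ^ (P.b * P.level m) = B, 2 ^ (2 * (P.b * P.level m)) = B2, 2 ^ P.level m = A,
      2 ^ (P.a * P.level m) = C at *
    generalize P.level m = k, levelTime P = L, P.D = D at *
    set X := A * (B2 + C) with hX
    have hX1 : A ≤ X := Nat.le_mul_of_pos_right _ (by omega)
    have hX2 : B2 + C ≤ X := Nat.le_mul_of_pos_left _ q0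
    have hm1 : m + 1 ≤ (m + 1) ^ 2 := Nat.le_self_pow two_ne_zero _
    have hm2 : (m + 1) * X ≤ (m + 1) ^ 2 * X := Nat.mul_le_mul_right _ hm1
    have hm3 : m + 1 ≤ (m + 1) * X := Nat.le_mul_of_pos_right _ (by omega)
    have hX3 : X ≤ (m + 1) * X := Nat.le_mul_of_pos_left _ (by omega)
    set Y := (m + 1) ^ 2 * X with hY
    have h1 : k * (L * (A + B + C) + 1) ≤ 2 * (L * Y) + Y := by
      have : k * (A + B + C) ≤ 2 * Y := by
        calc k * (A + B + C) ≤ m * (2 * X) := Nat.mul_le_mul hk (by omega)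
          _ = 2 * (m * X) := by ring
          _ ≤ 2 * ((m + 1) * X) := by gcongr; omega
          _ ≤ 2 * Y := by omega
      have := Nat.mul_le_mul_left L this
      calc k * (L * (A + B + C) + 1) = L * (k * (A + B + C)) + k := by ring
        _ ≤ L * (2 * Y) + Y := by omega
        _ = _ := by ring
    have h2 : A * (20000 * ((m + 1) ^ 2 * (B2 + C)) + 1) = 20000 * Y + A := by
      rw [hY, hX]; ring
    have h3 : D * 1 ≤ D * Y := Nat.mul_le_mul_left _ (by omega)
    have h4 : (200000 + 2 * D + 6 * L) * Y = 200000 * Y + 2 * (D * Y) + 6 * (L * Y) := by ring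
    rw [h2, h4]
    omega
  -- `drop` holds `m - (D - 1) - D * j`, which is positive exactly for `j < m / D`.
  · have h1 : P.D * (j + 1) ≤ m := (Nat.mul_le_mul_left _ hj).trans (Nat.mul_div_le _ _)
    have h2 := hP.pos
    rw [Nat.mul_add, mul_one] at h1
    simp only [levelRegs, stageRegs, Regs.set, Regs.get]
    rw [isCons_unary]
    omega
  · have h1 := Nat.lt_mul_div_succ m hP.pos
    have h2 := hP.pos
    rw [Nat.mul_add, mul_one] at h1
    simp only [levelRegs, stageRegs, Regs.set, Regs.get, Rates.level]
    rw [isCons_unary]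
    omega

/-- The program that computes the diagonal estimator. -/
def mainRoutine (P : Rates) : Prog :=
  .seq (block [(todo, .cons .nil inp)])
  (.seq (.loop todo.idx (stageRoutine P))
  (.seq (.seq (block [(t1, tab), (t2, inp)]) lookupRoutine) (block [(inp, t1)])))

theorem stageTime_mono {i j : ℕ} (h : i ≤ j) : stageTime P i ≤ stageTime P j := by
  have hk : P.level i ≤ P.level j := Rates.level_mono h
  unfold stageTime
  gcongr <;> norm_num

theorem runs_main (hP : P.Good) (x : List Bool) : ∃ s : Regs,
    s.inp = lookup (P.table (x.length + 1)) x ∧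
    Runs o (mainRoutine P) ((x.length + 1) * (stageTime P x.length + 1) + 26 * x.length + 100)
      (stageRegs 0 (ofBits x) nil nil) s := by
  set n := x.length with hn
  have H1 : Runs o (block [(todo, .cons .nil inp)]) 20 (stageRegs 0 (ofBits x) nil nil)
      (stageRegs 0 (ofBits x) (.cons nil (ofBits x)) nil) :=
    Runs.of_block (by
      simp only [blockExec, stageRegs, Regs.set, CellExpr.eval, Regs.get]) (by decide)
  have hlen : (Cell.cons nil (ofBits x)).toBits.length = n + 1 := by simp [hn]
  have H2 := Runs.loop (o := o) (x := todo) (p := stageRoutine P) (N := n + 1) (c := stageTime P n)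
    (fun j => stageRegs j (ofBits x) (snd^[j] (.cons nil (ofBits x))) (P.table j))
    (fun j hj => ⟨?_, ?_⟩) ?_
  · have H3 : Runs o _ (26 * n + 20 + 11) _
        (work (stageRegs (n + 1) (ofBits x) nil (P.table (n + 1))) nil nil (P.table (n + 1)) nil
          (lookup (P.table (n + 1)) (ofBits x).toBits) nil nil nil nil) :=
      runs_block_lookup (o := o) (l := [(t1, tab), (t2, inp)])
        (s₀ := stageRegs (n + 1) (ofBits x) nil (P.table (n + 1)))
        (s := stageRegs (n + 1) (ofBits x) nil (P.table (n + 1))) (by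
        simp only [blockExec, work, stageRegs, Regs.set, CellExpr.eval, Regs.get])
        (by simp [hn]) (by decide)
    rw [toBits_ofBits] at H3
    have H4 := runs_block (o := o) [(inp, t1)]
      (work (stageRegs (n + 1) (ofBits x) nil (P.table (n + 1))) nil nil (P.table (n + 1)) nil
          (lookup (P.table (n + 1)) x) nil nil nil nil)
    rw [iterate_snd_eq_nil hlen.le] at H2
    refine ⟨_, ?_, (H1.seq (H2.seq (H3.seq H4))).mono ?_⟩
    · simp only [blockExec, work, stageRegs, Regs.set, CellExpr.eval, Regs.get]
    · simp only [blockCost, CellExpr.cost]; omega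
  · simp only [stageRegs, Regs.get]
    rw [isCons_iterate_snd, hlen]
    exact hj
  · rw [Function.iterate_succ_apply']
    exact (runs_stage hP _ _).mono (stageTime_mono (by omega))
  · simp only [stageRegs, Regs.get]
    rw [isCons_iterate_snd, hlen]
    exact lt_irrefl _

theorem haltsWithin_main (hP : P.Good) (x : List Bool) :
    (mainRoutine P).HaltsWithin o (ofBits x) nil
      ((x.length + 1) * (stageTime P x.length + 1) + 26 * x.length + 100)
      (lookup (P.table (x.length + 1)) x) := by
  obtain ⟨s, hs, h⟩ := runs_main (o := o) hP x
  obtain ⟨ρ', hρ', t, ht, he⟩ := h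
    (fun i => if i = 0 then ofBits x else if i = 1 then nil else nil) (by
      intro y
      cases y <;> rfl)
  refine Prog.HaltsWithin.mono (t := t) ?_ ht
  have := he []
  rw [Prog.HaltsWithin, Prog.init, this]
  exact ⟨rfl, (hρ' inp).trans hs⟩

end Routine

namespace Rates

variable {P : Rates}

/-- With `k = level n`, the `n + 1` stages take time `2 ^ (k + 2 * b * k) + 2 ^ (k + a * k)` up to a
factor `(n + 1) ^ 3`, which is `O(2 ^ (3 * k))`; the conditions on the rates keep the product below
`2 ^ (D * k) ≤ 2 ^ n`. -/
theorem mainTime_le (hP : P.Good) (ha : P.a + 4 ≤ P.D) (hb : 2 * P.b + 4 ≤ P.D) (n : ℕ) :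
    (n + 1) * (Routine.stageTime P n + 1) + 26 * n + 100 ≤
      (2 * (200000 + 2 * P.D + 6 * Routine.levelTime P) * P.D ^ 3 + 200) * 2 ^ n := by
  have hn : n + 1 ≤ P.D * (P.level n + 1) := Nat.lt_mul_div_succ n hP.pos
  have hk : P.level n + 1 ≤ 2 ^ P.level n := Nat.lt_two_pow_self
  have hn2 : n + 1 ≤ 2 ^ n := Nat.lt_two_pow_self
  have hD : P.D * P.level n ≤ n := Nat.mul_div_le n P.D
  rw [Routine.stageTime]
  generalize 200000 + 2 * P.D + 6 * Routine.levelTime P = K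
  generalize P.level n = k at *
  have h1 : (n + 1) ^ 3 ≤ P.D ^ 3 * 2 ^ (3 * k) := by
    calc (n + 1) ^ 3 ≤ (P.D * 2 ^ k) ^ 3 := by
          gcongr; exact hn.trans (Nat.mul_le_mul_left _ hk)
      _ = _ := by rw [mul_pow, ← pow_mul, mul_comm k]
  have h2 : 2 ^ (2 * (P.b * k)) + 2 ^ (P.a * k) ≤ 2 * 2 ^ ((P.D - 4) * k) := by
    have e1 : 2 ^ (2 * (P.b * k)) ≤ 2 ^ ((P.D - 4) * k) := by
      rw [← mul_assoc]
      exact Nat.pow_le_pow_right two_pos (Nat.mul_le_mul_right _ (by omega))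
    have e2 : 2 ^ (P.a * k) ≤ 2 ^ ((P.D - 4) * k) :=
      Nat.pow_le_pow_right two_pos (Nat.mul_le_mul_right _ (by omega))
    omega
  have h3 : 2 ^ (3 * k) * (2 ^ k * 2 ^ ((P.D - 4) * k)) ≤ 2 ^ n := by
    rw [← pow_add, ← pow_add]
    refine Nat.pow_le_pow_right two_pos (le_trans (le_of_eq ?_) hD)
    obtain ⟨d, hd⟩ := Nat.exists_eq_add_of_le' (show 4 ≤ P.D by omega)
    rw [hd, Nat.add_sub_cancel]; ring
  have h4 : (n + 1) ^ 3 * (2 ^ k * (2 ^ (2 * (P.b * k)) + 2 ^ (P.a * k))) ≤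
      2 * P.D ^ 3 * 2 ^ n := by
    calc (n + 1) ^ 3 * (2 ^ k * (2 ^ (2 * (P.b * k)) + 2 ^ (P.a * k)))
        ≤ (P.D ^ 3 * 2 ^ (3 * k)) * (2 ^ k * (2 * 2 ^ ((P.D - 4) * k))) := by gcongr
      _ = 2 * P.D ^ 3 * (2 ^ (3 * k) * (2 ^ k * 2 ^ ((P.D - 4) * k))) := by ring
      _ ≤ _ := Nat.mul_le_mul_left _ h3
  have h5 := Nat.mul_le_mul_left K h4
  calc (n + 1) * (K * ((n + 1) ^ 2 * (2 ^ k * (2 ^ (2 * (P.b * k)) + 2 ^ (P.a * k)))) + 1) +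
        26 * n + 100
      = K * ((n + 1) ^ 3 * (2 ^ k * (2 ^ (2 * (P.b * k)) + 2 ^ (P.a * k)))) + (27 * n + 101) := by
        ring
    _ ≤ K * (2 * P.D ^ 3 * 2 ^ n) + 200 * 2 ^ n := by omega
    _ = _ := by ring

theorem estimator_mem_expTime (hP : P.Good) (ha : P.a + 4 ≤ P.D) (hb : 2 * P.b + 4 ≤ P.D) :
    P.estimator ∈ ExpTime 1 := by
  refine ⟨Routine.mainRoutine P, fun n => (n + 1) * (Routine.stageTime P n + 1) + 26 * n + 100,
    ?_, fun x => ⟨_, Routine.haltsWithin_main hP x, rfl⟩⟩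
  refine Asymptotics.IsBigO.of_bound
    ((2 * (200000 + 2 * P.D + 6 * Routine.levelTime P) * P.D ^ 3 + 200 : ℕ) : ℝ)
    (Eventually.of_forall fun n => ?_)
  rw [one_mul, Real.rpow_natCast, Real.norm_of_nonneg (by positivity),
    Real.norm_of_nonneg (by positivity)]
  exact_mod_cast mainTime_le hP ha hb n

end Rates

/-! ### The choice of the rates -/

/-- Since `m < 2 ^ s * (k + 1) ≤ 2 ^ (s + k)` at level `k`, the left side of the condition `count` is
at most `2 ^ (2 * s + 3 * k + b * k + 1)`, and `2 * s + 3 * k + 1 ≤ (2 * s + 4) * k` for `k ≥ 1`. At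
level `0` there are no simulations, and one string suffices. -/
theorem Rates.good_of_le {s a b : ℕ} (ha : a = b + 2 * s + 4) (haD : a ≤ 2 ^ s) :
    (Rates.mk (2 ^ s) a b).Good := by
  refine ⟨by positivity, haD, fun m => ?_⟩
  have hm : m + 1 ≤ 2 ^ s * (m / 2 ^ s + 1) := Nat.lt_mul_div_succ m (by positivity)
  simp only [Rates.level, Rates.clock, Rates.free]
  generalize m / 2 ^ s = k at *
  rcases Nat.eq_zero_or_pos k with rfl | hk
  · simp
  · have h1 : m + 1 ≤ 2 ^ (s + k) := by
      rw [pow_add]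
      exact hm.trans (Nat.mul_le_mul_left _ Nat.lt_two_pow_self)
    calc (m + 1) * (2 ^ k * (m * (2 ^ (b * k) - 1))) + 2 ^ k
        ≤ 2 ^ (s + k) * (2 ^ k * (2 ^ (s + k) * 2 ^ (b * k))) + 2 ^ k := by
          gcongr
          · omega
          · exact Nat.sub_le _ _
      _ = 2 ^ (2 * s + 3 * k + b * k) + 2 ^ k := by ring
      _ ≤ 2 ^ (2 * s + 3 * k + b * k) + 2 ^ (2 * s + 3 * k + b * k) := by
          gcongr <;> omega
      _ = 2 ^ (2 * s + 3 * k + b * k + 1) := by ring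
      _ ≤ 2 ^ (a * k) := by
          refine Nat.pow_le_pow_right two_pos ?_
          subst ha
          nlinarith [Nat.mul_le_mul_left s hk]

/-- The simulations need `ε * (D - a) < b`, and the regret needs `a + 1 < ε * D`. With `a` close to
`b = β * D`, these say `ε / (1 + ε) < β < ε`; the time bound needs `β < 1 / 2`, which is compatible
as `ε / (1 + ε) < 1 / 2`. The difference `a - b` is logarithmic in `D = 2 ^ s` and is absorbed by
taking `s` large. -/
theorem exists_rates {ε : ℝ} (h0 : 0 < ε) (h1 : ε < 1) : ∃ P : Rates, P.Good ∧
    P.a + 4 ≤ P.D ∧ 2 * P.b + 4 ≤ P.D ∧ ε * (P.D - P.a) < P.b ∧ (P.a + 1 : ℝ) < ε * P.D := by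
  obtain ⟨β, hβ1, hβ2⟩ : ∃ β, ε / (1 + ε) < β ∧ β < min ε (1 / 2) := by
    refine exists_between (lt_min ?_ ?_)
    · rw [div_lt_iff₀ (by linarith)]; nlinarith
    · rw [div_lt_div_iff₀ (by linarith) two_pos]; linarith
  rw [div_lt_iff₀ (by linarith)] at hβ1
  obtain ⟨hβ3, hβ4⟩ := lt_min_iff.1 hβ2
  have hβ0 : 0 < β := by
    by_contra h
    nlinarith
  obtain ⟨γ, hγ0, hγ⟩ : ∃ γ, 0 < γ ∧ γ < min (min (ε - β) (1 - 2 * β)) (β * (1 + ε) - ε) :=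
    exists_between (lt_min (lt_min (by linarith) (by linarith)) (by linarith))
  obtain ⟨⟨hγ1, hγ2⟩, hγ3⟩ := (lt_min_iff.1 hγ).imp_left lt_min_iff.1
  obtain ⟨s, hs⟩ : ∃ s : ℕ, 2 * (s : ℝ) + 20 ≤ γ * 2 ^ s := by
    have e1 : (fun s : ℕ => (s : ℝ)) =o[atTop] fun s : ℕ => (2 : ℝ) ^ s :=
      isLittleO_coe_const_pow_of_one_lt one_lt_two
    have e2 := e1.bound (show 0 < γ / 22 by positivity)
    obtain ⟨s, hs, hs1⟩ := (e2.and (eventually_ge_atTop 1)).exists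
    refine ⟨s, ?_⟩
    rw [Real.norm_of_nonneg (by positivity), Real.norm_of_nonneg (by positivity)] at hs
    have : (1 : ℝ) ≤ s := by exact_mod_cast hs1
    linarith
  set b := ⌊β * 2 ^ s⌋₊ with hb
  have hb1 : (b : ℝ) ≤ β * 2 ^ s := Nat.floor_le (by positivity)
  have hb2 : β * 2 ^ s < b + 1 := Nat.lt_floor_add_one _
  have hD : (0 : ℝ) < 2 ^ s := by positivity
  have m1 := mul_lt_mul_of_pos_right hγ1 hD
  have m2 := mul_lt_mul_of_pos_right hγ2 hD
  have m3 := mul_lt_mul_of_pos_right hγ3 hD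
  have m4 := mul_lt_mul_of_pos_right h1 hD
  have haD : b + 2 * s + 4 + 4 ≤ 2 ^ s := by
    have : ((b + 2 * s + 4 + 4 : ℕ) : ℝ) ≤ ((2 ^ s : ℕ) : ℝ) := by push_cast; linarith
    exact_mod_cast this
  refine ⟨⟨2 ^ s, b + 2 * s + 4, b⟩, Rates.good_of_le rfl (by omega), haD, ?_, ?_, ?_⟩
  · have : ((2 * b + 4 : ℕ) : ℝ) ≤ ((2 ^ s : ℕ) : ℝ) := by push_cast; linarith
    exact_mod_cast this
  · push_cast
    nlinarith [mul_lt_mul_of_pos_left hb2 h0, Nat.cast_nonneg (α := ℝ) s]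
  · push_cast
    linarith

/-! ### The regret of an online estimator -/

theorem IsOnline.append_le {q : List Bool → ℝ} (hq : IsOnline q) (w y : List Bool) :
    q (w ++ y) ≤ q w := by
  induction y using List.reverseRecOn with
  | nil => simp
  | append_singleton y b ih =>
    rw [← List.append_assoc]
    refine le_trans ?_ ih
    have h1 := hq.2.2 (w ++ y)
    have h2 := hq.1 (w ++ y ++ [false])
    have h3 := hq.1 (w ++ y ++ [true])
    cases b <;> linarith

/-- A string that is chosen greedily against approximations of an online estimator is unlikely. -/
theorem IsOnline.take_le {q : List Bool → ℝ} (hq : IsOnline q) {x : List Bool} {L : ℕ}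
    {c : List Bool → Cell} {δ : ℝ} (hL : L ≤ x.length)
    (hc : ∀ w : List Bool, w.length < L → |((c w).toRat : ℝ) - q (w ++ [false])| < δ)
    (hx : ∀ i < L, x.take (i + 1) = x.take i ++ [!Rates.isLow (i + 1) (c (x.take i))]) :
    ∀ i ≤ L, q (x.take i) ≤ (2 ^ i)⁻¹ + i * δ := by
  intro i
  induction i with
  | zero => intro _; simp [hq.2.1]
  | succ i ih =>
    intro hi
    have h1 := ih (by omega)
    have h2 := abs_lt.1 (hc (x.take i) (by rw [List.length_take]; omega))
    have h3 := hq.2.2 (x.take i)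
    have h4 : ((2 : ℝ) ^ (i + 1))⁻¹ = (2 ^ i)⁻¹ / 2 := by rw [pow_succ, mul_inv]; ring
    rw [hx i (by omega)]
    have h5 : Rates.isLow (i + 1) (c (x.take i)) = true ↔
        ((c (x.take i)).toRat : ℝ) ≤ (2 ^ (i + 1))⁻¹ := by
      rw [Rates.isLow, decide_eq_true_iff, ← NNRat.cast_le (K := ℝ)]
      push_cast
      rfl
    cases h : Rates.isLow (i + 1) (c (x.take i))
    · have h6 : ¬ ((c (x.take i)).toRat : ℝ) ≤ (2 ^ (i + 1))⁻¹ := by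
        rw [← h5, h]; exact Bool.false_ne_true
      rw [not_le] at h6
      push_cast
      simp only [Bool.not_false]
      linarith
    · have h6 := h5.1 h
      have h7 : 0 ≤ (i : ℝ) * δ := mul_nonneg (by positivity) (by linarith)
      push_cast
      simp only [Bool.not_true]
      linarith

theorem le_regret {q' : List Bool → ℝ} {q : List Bool → ℚ≥0} {x : List Bool} {r : ℝ}
    (h0 : 0 < q x) (h : Real.exp r * q' x ≤ q x) : (r : EReal) ≤ regret q' q x.length := by
  have h1 : (r : EReal) ≤ ENNReal.log (ENNReal.ofReal (q x : ℝ) / ENNReal.ofReal (q' x)) := by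
    rw [show (r : EReal) = ENNReal.log (ENNReal.ofReal (Real.exp r)) by
      rw [ENNReal.log_ofReal_of_pos (Real.exp_pos r), Real.log_exp]]
    refine ENNReal.log_monotone ?_
    have h0' : ENNReal.ofReal (q x : ℝ) ≠ 0 := by
      rw [Ne, ENNReal.ofReal_eq_zero, not_le]
      exact_mod_cast h0
    rw [ENNReal.le_div_iff_mul_le (.inr h0') (.inl ENNReal.ofReal_ne_top),
      ← ENNReal.ofReal_mul (Real.exp_pos r).le]
    exact ENNReal.ofReal_le_ofReal h
  refine h1.trans ?_
  have := le_iSup (fun y : Fin x.length → Bool =>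
    ENNReal.log (ENNReal.ofReal (q (List.ofFn y) : ℝ) / ENNReal.ofReal (q' (List.ofFn y)))) x.get
  simpa only [List.ofFn_get, regret] using this

theorem IsOnline.sum_eq_one {q : List Bool → ℝ} (hq : IsOnline q) (n : ℕ) :
    ∑ x : Fin n → Bool, q (List.ofFn x) = 1 := by
  induction n with
  | zero => simp [hq.2.1]
  | succ n ih =>
    rw [← (Fin.snocEquiv fun _ : Fin (n + 1) => Bool).sum_comp, Fintype.sum_prod_type_right, ← ih]
    refine Finset.sum_congr rfl fun y _ => ?_
    have : ∀ b : Bool, List.ofFn (Fin.snocEquiv (fun _ : Fin (n + 1) => Bool) (b, y)) =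
        List.ofFn y ++ [b] := by
      intro b
      rw [List.ofFn_succ']
      simp [Fin.snocEquiv]
    simp only [this, Fintype.sum_bool]
    rw [add_comm]
    exact hq.2.2 _

/-- As both estimators have mass `1` on the strings of length `n`, some string in the support of the
offline one is at most as likely for the online one. -/
theorem regret_nonneg {q' : List Bool → ℝ} {q : List Bool → ℚ≥0} (hq' : IsOnline q')
    (hq : IsOffline q) (n : ℕ) : 0 ≤ regret q' q n := by
  have h1 : ∑ x : Fin n → Bool, ((q (List.ofFn x) : ℚ≥0) : ℝ) = 1 := by
    exact_mod_cast congrArg (NNRat.cast (K := ℝ)) (hq n)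
  obtain ⟨x, hx, hle⟩ : ∃ x : Fin n → Bool, 0 < q (List.ofFn x) ∧
      q' (List.ofFn x) ≤ q (List.ofFn x) := by
    by_contra! hlt
    obtain ⟨x, -, hx⟩ := Finset.exists_ne_zero_of_sum_ne_zero (ne_of_eq_of_ne (hq n) one_ne_zero)
    have : ∑ x : Fin n → Bool, ((q (List.ofFn x) : ℚ≥0) : ℝ) <
        ∑ x : Fin n → Bool, q' (List.ofFn x) := by
      refine Finset.sum_lt_sum (fun y _ => ?_) ⟨x, Finset.mem_univ _, hlt x (pos_of_ne_zero hx)⟩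
      rcases eq_or_ne (q (List.ofFn y)) 0 with h | h
      · rw [h, NNRat.cast_zero]; exact hq'.1 _
      · exact (hlt y (pos_of_ne_zero h)).le
    rw [h1, hq'.sum_eq_one] at this
    exact lt_irrefl _ this
  have := le_regret (q' := q') (q := q) (r := 0) hx (by rw [Real.exp_zero, one_mul]; exact hle)
  rwa [List.length_ofFn] at this

theorem oraclePolyTime_subset (o : List Bool → ℚ≥0) {c : ℝ} (hc : 0 < c) :
    OraclePolyTime o ⊆ OracleExpTime o c := by
  intro q hq
  obtain ⟨k, p, t, ht, h⟩ := Set.mem_iUnion.1 hq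
  refine ⟨p, t, ht.trans ?_, h⟩
  have := isLittleO_pow_const_const_pow_of_one_lt (R := ℝ) k
    (Real.one_lt_rpow one_lt_two hc)
  simpa only [Real.rpow_mul_natCast two_pos.le] using this.isBigO

namespace Rates

variable {P : Rates}

theorem tendsto_level (hD : 0 < P.D) : Tendsto P.level atTop atTop :=
  Nat.tendsto_div_const_atTop hD.ne'

/-- The simulations are long enough for programs that run in time `2 ^ (ε / 2 * n)`. -/
theorem eventually_time_le_clock (hP : P.Good) {ε : ℝ} (h0 : 0 < ε)
    (hb : ε * (P.D - P.a) < P.b) {t : ℕ → ℕ}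
    (ht : (fun n => (t n : ℝ)) =O[atTop] fun n : ℕ => (2 : ℝ) ^ (ε / 2 * (n : ℝ))) :
    ∀ᶠ m : ℕ in atTop, ∀ N ≤ 2 * P.bound m + 2, t N ≤ P.clock m := by
  obtain ⟨C, hC, ht⟩ := Asymptotics.bound_of_isBigO_nat_atTop ht
  have hγ : 0 < (P.b : ℝ) - ε * (P.D - P.a) := by linarith
  have hlim : Tendsto (fun m => ((2 : ℝ) ^ ((P.b : ℝ) - ε * (P.D - P.a))) ^ P.level m) atTop atTop :=
    (tendsto_pow_atTop_atTop_of_one_lt (Real.one_lt_rpow one_lt_two hγ)).comp (tendsto_level hP.pos)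
  -- As `bound m ≤ (D - a) * level m + D`, the time is `O(2 ^ (ε * (D - a) * level m))`.
  filter_upwards [hlim.eventually_ge_atTop (C * 2 ^ (ε * (P.D + 1)) + 1)] with m hm N hN
  have h1 := ht (x := N) (by positivity)
  rw [Real.norm_of_nonneg (by positivity), Real.norm_of_nonneg (by positivity)] at h1
  have hDa : (P.a : ℝ) ≤ P.D := by exact_mod_cast hP.free_le
  have hL : (P.bound m : ℝ) ≤ (P.D - P.a) * P.level m + P.D := by
    have e1 : (P.bound m : ℝ) + P.a * P.level m = m := by
      exact_mod_cast bound_add_free hP.free_le m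
    have e2 : (m : ℝ) ≤ P.D * (P.level m + 1) := by
      exact_mod_cast (Nat.lt_mul_div_succ m hP.pos).le
    linarith
  have hN' : (N : ℝ) ≤ 2 * P.bound m + 2 := by exact_mod_cast hN
  have h2 : (2 : ℝ) ^ (ε / 2 * (N : ℝ)) ≤
      2 ^ (ε * (P.D + 1)) * 2 ^ (ε * (P.D - P.a) * P.level m) := by
    rw [← Real.rpow_add two_pos]
    refine Real.rpow_le_rpow_of_exponent_le one_le_two ?_
    nlinarith
  set A : ℝ := 2 ^ (ε * (P.D - P.a) * P.level m) with hA
  have hA1 : 1 ≤ A := Real.one_le_rpow one_le_two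
    (mul_nonneg (mul_nonneg h0.le (by linarith)) (by positivity))
  have h3 : ((2 : ℝ) ^ ((P.b : ℝ) - ε * (P.D - P.a))) ^ P.level m * A = 2 ^ (P.b * P.level m) := by
    rw [← Real.rpow_mul_natCast two_pos.le, hA, ← Real.rpow_add two_pos, ← Real.rpow_natCast]
    congr 1
    push_cast; ring
  have h4 : (t N : ℝ) + 1 ≤ 2 ^ (P.b * P.level m) := by
    rw [← h3]
    calc (t N : ℝ) + 1 ≤ C * (2 ^ (ε * (P.D + 1)) * A) + A :=
          add_le_add (h1.trans (mul_le_mul_of_nonneg_left h2 hC.le)) hA1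
      _ = (C * 2 ^ (ε * (P.D + 1)) + 1) * A := by ring
      _ ≤ _ := mul_le_mul_of_nonneg_right hm (by linarith)
  have h5 : t N + 1 ≤ 2 ^ (P.b * P.level m) := by exact_mod_cast h4
  exact Nat.le_sub_of_add_le h5

/-- The greedy part of a string is so much longer than its level that the ratio of its probability
`2 ^ (-level)` to the bound from `IsOnline.take_le` exceeds `2 ^ ((1 - ε) * m)`. -/
theorem eventually_bound_large (hP : P.Good) {ε : ℝ} (ha : (P.a + 1 : ℝ) < ε * P.D) :
    ∀ᶠ m : ℕ in atTop, Real.exp ((1 - ε) * m * Real.log 2) *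
      ((1 + P.bound m) * (2 ^ P.bound m)⁻¹) ≤ (2 ^ P.level m : ℝ)⁻¹ := by
  have hD : (0 : ℝ) < P.D := by exact_mod_cast hP.pos
  have hγ : 0 < ε - (P.a + 1) / P.D := by
    rw [sub_pos, div_lt_iff₀ hD]; exact ha
  have e1 : (fun m : ℕ => (m : ℝ)) =o[atTop] fun m : ℕ => ((2 : ℝ) ^ (ε - (P.a + 1) / P.D)) ^ m :=
    isLittleO_coe_const_pow_of_one_lt (Real.one_lt_rpow one_lt_two hγ)
  filter_upwards [e1.bound (show (0 : ℝ) < 1 / 2 by norm_num), eventually_ge_atTop 1] with m hm hm1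
  rw [Real.norm_of_nonneg (by positivity), Real.norm_of_nonneg (by positivity)] at hm
  have h1 : (1 : ℝ) ≤ m := by exact_mod_cast hm1
  have e2 : (P.bound m : ℝ) + P.a * P.level m = m := by
    exact_mod_cast bound_add_free hP.free_le m
  have e3 : (P.level m : ℝ) * P.D ≤ m := by
    exact_mod_cast Nat.div_mul_le_self m P.D
  rw [← le_div_iff₀ hD] at e3
  have h2 : (1 + P.bound m : ℝ) ≤ 2 ^ ((ε - (P.a + 1) / P.D) * m) := by
    rw [Real.rpow_mul_natCast two_pos.le]
    have : (0 : ℝ) ≤ P.a * P.level m := by positivity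
    linarith
  have e4 : Real.exp ((1 - ε) * m * Real.log 2) = 2 ^ ((1 - ε) * m) := by
    rw [Real.rpow_def_of_pos two_pos, mul_comm]
  have e5 : ((2 : ℝ) ^ P.bound m)⁻¹ = 2 ^ (-(P.bound m : ℝ)) := by
    rw [Real.rpow_neg two_pos.le, Real.rpow_natCast]
  have e6 : ((2 : ℝ) ^ P.level m)⁻¹ = 2 ^ (-(P.level m : ℝ)) := by
    rw [Real.rpow_neg two_pos.le, Real.rpow_natCast]
  rw [e4, e5, e6]
  calc (2 : ℝ) ^ ((1 - ε) * m) * ((1 + P.bound m) * 2 ^ (-(P.bound m : ℝ)))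
      ≤ 2 ^ ((1 - ε) * m) * (2 ^ ((ε - (P.a + 1) / P.D) * m) * 2 ^ (-(P.bound m : ℝ))) := by gcongr
    _ = 2 ^ ((1 - ε) * m + ((ε - (P.a + 1) / P.D) * m + -(P.bound m : ℝ))) := by
        rw [← Real.rpow_add two_pos, ← Real.rpow_add two_pos]
    _ ≤ _ := by
        refine Real.rpow_le_rpow_of_exponent_le one_le_two ?_
        have h3 : (P.a + 1 : ℝ) * P.level m ≤ (P.a + 1) * (m / P.D) := by gcongr
        have h4 : (P.a + 1 : ℝ) / P.D * m = (P.a + 1) * (m / P.D) := by ring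
        linarith

/-- An online estimator has large regret if the program that approximates it is among the simulated
ones and is run long enough. -/
theorem eventually_le_regret (hP : P.Good) {ε : ℝ} (h0 : 0 < ε)
    (hb : ε * (P.D - P.a) < P.b) (ha : (P.a + 1 : ℝ) < ε * P.D) {q : List Bool → ℝ}
    (hq : IsOnline q) (hqt : q ∈ OracleExpTime P.estimator (ε / 2)) :
    ∀ᶠ n : ℕ in atTop,
      (((1 - ε) * (n : ℝ) * Real.log 2 : ℝ) : EReal) ≤ regret q P.estimator n := by
  obtain ⟨p, t, ht, hp⟩ := hqt
  filter_upwards [exists_diagonal hP p, eventually_time_le_clock hP h0 hb ht,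
    eventually_bound_large hP ha] with m hdiag htime hlarge
  have hδ : 0 < P.precision m := by unfold precision; positivity
  choose c hc happ using fun w : List Bool => hp (w ++ [false]) (P.precision m) hδ
  obtain ⟨x, hx, hox, hgr⟩ := hdiag c fun w hw => (hc w).mono (htime _ (by
    rw [precision, Cell.ratLength_inv_two_pow, List.length_append, List.length_singleton]
    omega))
  have hL : P.bound m ≤ x.length := by rw [hx]; exact Nat.sub_le _ _
  have h1 := hq.take_le hL (fun w _ => happ w) hgr _ le_rfl
  have h2 := hq.append_le (x.take (P.bound m)) (x.drop (P.bound m))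
  rw [List.take_append_drop] at h2
  have h3 : q x ≤ (1 + P.bound m) * (2 ^ P.bound m)⁻¹ := by
    refine (h2.trans h1).trans (le_of_eq ?_)
    rw [precision]
    push_cast
    ring
  have h4 := le_regret (q' := q) (q := P.estimator) (x := x)
    (r := (1 - ε) * m * Real.log 2) (by rw [hox, weight]; positivity) (by
      rw [hox, weight]
      push_cast
      exact (mul_le_mul_of_nonneg_left h3 (Real.exp_pos _).le).trans hlarge)
  rwa [hx] at h4

end Rates

theorem theorem5 (ε : ℝ) (hε : 0 < ε) :
    ∃ o : List Bool → ℚ≥0, IsOffline o ∧ o ∈ ExpTime 1 ∧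
      (∀ q : List Bool → ℝ, IsOnline q → q ∈ OracleExpTime o (ε / 2) →
        ∀ᶠ n : ℕ in atTop, (((1 - ε) * (n : ℝ) * Real.log 2 : ℝ) : EReal) ≤ regret q o n) ∧
      (∀ q : List Bool → ℝ, IsOnline q → q ∈ OraclePolyTime o →
        ∀ᶠ n : ℕ in atTop, (((1 - ε) * (n : ℝ) * Real.log 2 : ℝ) : EReal) ≤ regret q o n) := by
  rcases lt_or_ge ε 1 with h1 | h1
  · obtain ⟨P, hP, ha, hb, hεb, hεa⟩ := exists_rates hε h1
    have key := fun (q : List Bool → ℝ) (hq : IsOnline q) =>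
      Rates.eventually_le_regret hP hε hεb hεa hq
    exact ⟨P.estimator, Rates.isOffline_estimator hP, Rates.estimator_mem_expTime hP ha hb, key,
      fun q hq h => key q hq (oraclePolyTime_subset _ (half_pos hε) h)⟩
  · obtain ⟨P, hP, ha, hb, -, -⟩ := exists_rates (ε := 1 / 2) (by norm_num) (by norm_num)
    -- The claimed bound is not positive, and the regret is never negative.
    have key : ∀ (q : List Bool → ℝ), IsOnline q → ∀ᶠ n : ℕ in atTop,
        (((1 - ε) * (n : ℝ) * Real.log 2 : ℝ) : EReal) ≤ regret q P.estimator n := by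
      refine fun q hq => .of_forall fun n =>
        le_trans ?_ (regret_nonneg hq (Rates.isOffline_estimator hP) n)
      have h2 := Real.log_pos one_lt_two
      have : (1 - ε) * (n : ℝ) * Real.log 2 ≤ 0 :=
        mul_nonpos_of_nonpos_of_nonneg (mul_nonpos_of_nonpos_of_nonneg (by linarith) (by positivity))
          h2.le
      exact_mod_cast this
    exact ⟨P.estimator, Rates.isOffline_estimator hP, Rates.estimator_mem_expTime hP ha hb,
      fun q hq _ => key q hq, fun q hq _ => key q hq⟩
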